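/- Let $\mathfrak g$ be a finite-dimensional nilpotent real Lie algebra and let $G$ be the connected, simply connected Lie group with Lie algebra $\mathfrak g$; as usual, $G$ is identified with $\mathfrak g$ through the bijection $\exp$, so that its product is the Baker–Campbell–Hausdorff product. Suppose that $G$ carries an integrable left-invariant horizontal CR structure of type $(n,k)$: there are a subspace $\mathfrak h\subset\mathfrak g$ that generates $\mathfrak g$ as a Lie algebra, with $\dim\mathfrak h=2n$, an ideal $\mathfrak n$ of $\mathfrak g$ with $\mathfrak g=\mathfrak h\oplus\mathfrak n$ and $\dim\mathfrak n=k$, and a linear map $J:\mathfrak h\to\mathfrak h$ with $J^2=-1$, such that for all $X,Y\in\mathfrak h$ $$[X,Y]-[JX,JY]\in\mathfrak h\quad\text{and}\quad [X,JY]+[JX,Y]=J([X,Y]-[JX,JY]).$$ Let $G_{\mathbb C}\supset G$ be the connected, simply connected complex Lie group with Lie algebra $\mathfrak g_{\mathbb C}=\mathbb C\otimes\mathfrak g$, also in exponential coordinates, and put $\mathfrak h^{01}=\{X+iJX: X\in\mathfrak h\}$, $\mathfrak h^{10}=\{X-iJX:X\in\mathfrak h\}$, $\mathfrak m=\mathfrak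 h^{10}\oplus\mathfrak n_{\mathbb C}$, $H^{01}=\exp\mathfrak h^{01}$ and $M=\exp\mathfrak m$. There are bases of $\mathfrak h$ of the form $X_1,\dots,X_n,JX_1,\dots,JX_n$ and bases $T_1,\dots,T_k$ of $\mathfrak n$, and for every choice of such bases the following holds. The map $(z,w)\mapsto\exp\big(\sum_j \tfrac{z_j}{2}(X_j-iJX_j)+\sum_l w_lT_l\big)$ is a bijection of $\mathbb C^{n+k}$ onto $M$, by which the two are identified. Every coset $pH^{01}$ with $p\in G_{\mathbb C}$ contains exactly one point $\Phi(p)$ of $M$; this defines $\Phi:G_{\mathbb C}\to M\cong\mathbb C^{n+k}$. The restriction $\iota=\Phi|_G$ is a CR embedding of $G$ into $\mathbb C^{n+k}$, that is, a smooth embedding whose differential maps vectors of type $(0,1)$ to vectors of type $(0,1)$; equivalently, $\iota_*(JX)=i\,\iota_*(X)$ for the left-invariant vector fields given by $X\in\mathfrak h$. In the coordinates $(x,y,t)\mapsto\exp\big(\sum_j(x_jX_j+y_jJX_j)+\sum_l t_lT_l\big)$ of $G$ it has the form $$(x,y,t)\mapsto\big(x+iy+p(x,y),\ t+q(x,y,t)\big)$$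 with vectors $p$ and $q$ of complex polynomials. Moreover, $\Phi$ has a right inverse $\Phi_R^{-1}:\mathbb C^{n+k}\to G_{\mathbb C}$ with $\Phi_R^{-1}(\iota(g))=g$ for all $g\in G$, such that $$v\ast w:=\Phi\big(\Phi_R^{-1}(v)\,\Phi_R^{-1}(w)\big)$$ is a group law on $\mathbb C^{n+k}$ and $\Phi_R^{-1}$ is a homomorphism from $(\mathbb C^{n+k},\ast)$ to $G_{\mathbb C}$. With this product $\iota$ is an injective homomorphism from $G$ into $(\mathbb C^{n+k},\ast)$, and its image is a subgroup; so $\iota$ realises $G$ as a subgroup of $(\mathbb C^{n+k},\ast)$. -/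

import Mathlib

open scoped TensorProduct ContDiff

noncomputable section

/-! ### Simply connected nilpotent Lie groups in exponential coordinates -/

/-- The iterated bracket `[a₁, [a₂, … [aₘ₋₁, aₘ] … ]]` of a nonempty list. -/
def nestedBracket {L : Type*} [LieRing L] : List L → L
  | [] => 0
  | [a] => a
  | a :: b :: l => ⁅a, nestedBracket (b :: l)⁆

/-- The Baker–Campbell–Hausdorff product on a nilpotent Lie algebra, by Dynkin's formula
`∑ₘ (-1)^(m-1)/m ∑ (∑ᵢ (rᵢ + sᵢ))⁻¹ (∏ᵢ rᵢ! sᵢ!)⁻¹ [x^{r₁} y^{s₁} ⋯ x^{rₘ} y^{sₘ}]`,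
the inner sum being over all `(rᵢ, sᵢ)` with `rᵢ + sᵢ > 0` for `i = 1, …, m`.
Brackets with more entries than the nilpotency length vanish, so that the terms with some
`m`, `rᵢ` or `sᵢ` above the nilpotency length may be left out. -/
def bch (K : Type*) {L : Type*} [Field K] [LieRing L] [LieAlgebra K L] (x y : L) : L :=
  ∑ m ∈ Finset.Icc 1 (LieModule.nilpotencyLength L L),
    ∑ p ∈ Fintype.piFinset (fun _ : Fin m =>
        ((Finset.range (LieModule.nilpotencyLength L L + 1)) ×ˢ
          (Finset.range (LieModule.nilpotencyLength L L + 1))).filter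
            (fun rs : ℕ × ℕ => 0 < rs.1 + rs.2)),
      ((-1 : K) ^ (m - 1) / (m : K) * ((∑ i, ((p i).1 + (p i).2) : ℕ) : K)⁻¹ *
          ∏ i, (((p i).1.factorial * (p i).2.factorial : ℕ) : K)⁻¹) •
        nestedBracket (List.ofFn fun i =>
          List.replicate (p i).1 x ++ List.replicate (p i).2 y).flatten

/-- The connected, simply connected Lie group of a nilpotent Lie algebra `L` over `K`, in
exponential coordinates: its points are `exp X` for `X` in `L`, with `exp` a bijection,
and its product is the Baker–Campbell–Hausdorff product. -/
@[ext]
structure ExpGroup (K L : Type*) where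
  exp ::
  log : L

instance ExpGroup.instMul (K L : Type*) [Field K] [LieRing L] [LieAlgebra K L] :
    Mul (ExpGroup K L) :=
  ⟨fun p q => ExpGroup.exp (bch K p.log q.log)⟩

/-- The inclusion of `G` in its complexification `G_ℂ`, the group of the Lie algebra
`ℂ ⊗ 𝔤`. -/
def ExpGroup.complexify {𝔤 : Type*} [LieRing 𝔤] [LieAlgebra ℝ 𝔤] (p : ExpGroup ℝ 𝔤) :
    ExpGroup ℂ (ℂ ⊗[ℝ] 𝔤) :=
  ExpGroup.exp ((1 : ℂ) ⊗ₜ[ℝ] p.log)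

/-! ### Horizontal CR structures -/

/-- An integrable left-invariant horizontal CR structure on the group of `𝔤`: a subspace `𝔥`
that generates the Lie algebra `𝔤`, a complementary ideal `𝔫`, and an almost complex
structure `J` on `𝔥` such that `[X, JY] + [JX, Y] = J ([X, Y] - [JX, JY])`, where
`[X, Y] - [JX, JY]` belongs to `𝔥`. -/
structure HorizontalCRStructure (𝔤 : Type*) [LieRing 𝔤] [LieAlgebra ℝ 𝔤] where
  𝔥 : Submodule ℝ 𝔤
  𝔫 : LieIdeal ℝ 𝔤
  J : 𝔥 →ₗ[ℝ] 𝔥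
  isCompl : IsCompl 𝔥 (𝔫 : Submodule ℝ 𝔤)
  generates : LieSubalgebra.lieSpan ℝ 𝔤 (𝔥 : Set 𝔤) = ⊤
  J_J : ∀ X : 𝔥, J (J X) = -X
  integrable : ∀ X Y : 𝔥, ∃ Z : 𝔥,
    (Z : 𝔤) = ⁅(X : 𝔤), (Y : 𝔤)⁆ - ⁅(J X : 𝔤), (J Y : 𝔤)⁆ ∧
    (J Z : 𝔤) = ⁅(X : 𝔤), (J Y : 𝔤)⁆ + ⁅(J X : 𝔤), (Y : 𝔤)⁆

namespace HorizontalCRStructure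

variable {𝔤 : Type*} [LieRing 𝔤] [LieAlgebra ℝ 𝔤] (S : HorizontalCRStructure 𝔤)

/-- The CR structure has type `(n, k)`, where `2n = dim 𝔥` and `k = dim 𝔫`. -/
def IsOfType (n k : ℕ) : Prop :=
  Module.finrank ℝ S.𝔥 = 2 * n ∧ Module.finrank ℝ S.𝔫 = k

/-- `𝔥⁰¹ = {X + iJX : X ∈ 𝔥}`. -/
def h01 : Set (ℂ ⊗[ℝ] 𝔤) :=
  Set.range fun X : S.𝔥 => (1 : ℂ) ⊗ₜ[ℝ] (X : 𝔤) + Complex.I ⊗ₜ[ℝ] (S.J X : 𝔤)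

/-- `𝔥¹⁰ = {X - iJX : X ∈ 𝔥}`, the complex conjugate of `𝔥⁰¹`. -/
def h10 : Set (ℂ ⊗[ℝ] 𝔤) :=
  Set.range fun X : S.𝔥 => (1 : ℂ) ⊗ₜ[ℝ] (X : 𝔤) - Complex.I ⊗ₜ[ℝ] (S.J X : 𝔤)

/-- `𝔪 = 𝔥¹⁰ + 𝔫_ℂ`. -/
def 𝔪 : Submodule ℂ (ℂ ⊗[ℝ] 𝔤) :=
  Submodule.span ℂ S.h10 ⊔ (S.𝔫 : Submodule ℝ 𝔤).baseChange ℂ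

/-- `H⁰¹ = exp 𝔥⁰¹`. -/
def H01 : Set (ExpGroup ℂ (ℂ ⊗[ℝ] 𝔤)) :=
  ExpGroup.exp '' S.h01

/-- `M = exp 𝔪`. -/
def M : Set (ExpGroup ℂ (ℂ ⊗[ℝ] 𝔤)) :=
  ExpGroup.exp '' (S.𝔪 : Set (ℂ ⊗[ℝ] 𝔤))

/-- A basis `X₁, …, Xₙ, JX₁, …, JXₙ` of `𝔥` and a basis `T₁, …, Tₖ` of `𝔫`. -/
structure AdaptedBasis (n k : ℕ) where
  X : Module.Basis (Fin n ⊕ Fin n) ℝ S.𝔥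
  X_inr : ∀ j : Fin n, X (Sum.inr j) = S.J (X (Sum.inl j))
  T : Module.Basis (Fin k) ℝ S.𝔫

end HorizontalCRStructure

/-- The space `ℂⁿ⁺ᵏ`, written as `ℂⁿ × ℂᵏ`. -/
abbrev CSpace (n k : ℕ) : Type := (Fin n → ℂ) × (Fin k → ℂ)

namespace HorizontalCRStructure.AdaptedBasis

variable {𝔤 : Type*} [LieRing 𝔤] [LieAlgebra ℝ 𝔤] {S : HorizontalCRStructure 𝔤} {n k : ℕ}
  (B : S.AdaptedBasis n k)

/-- The exponential coordinates `(x, y, t)` of the point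
`exp (∑ⱼ (xⱼ Xⱼ + yⱼ JXⱼ) + ∑ₗ tₗ Tₗ)` of `G`. -/
def chart (a : (Fin n → ℝ) × (Fin n → ℝ) × (Fin k → ℝ)) : ExpGroup ℝ 𝔤 :=
  ExpGroup.exp (∑ j, (a.1 j • (B.X (Sum.inl j) : 𝔤) + a.2.1 j • (B.X (Sum.inr j) : 𝔤)) +
    ∑ l, a.2.2 l • (B.T l : 𝔤))

/-- The exponential coordinates `(z, w)` of the point
`exp (∑ⱼ zⱼ (Xⱼ - iJXⱼ) / 2 + ∑ₗ wₗ Tₗ)` of `M`. -/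
def chartM (v : CSpace n k) : ExpGroup ℂ (ℂ ⊗[ℝ] 𝔤) :=
  ExpGroup.exp (∑ j, (v.1 j / 2) • ((1 : ℂ) ⊗ₜ[ℝ] (B.X (Sum.inl j) : 𝔤) -
      Complex.I ⊗ₜ[ℝ] (B.X (Sum.inr j) : 𝔤)) +
    ∑ l, v.2 l • ((1 : ℂ) ⊗ₜ[ℝ] (B.T l : 𝔤)))

/-- `f : G → ℂⁿ⁺ᵏ` is a CR embedding: a smooth embedding (a smooth immersion that is a
homeomorphism onto its image) whose differential maps vectors of type `(0, 1)` to vectors of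
type `(0, 1)`. With `X` also denoting the left-invariant vector field of `X` in `𝔥`, whose
value at `p` is the velocity of `t ↦ p exp(tX)` at `t = 0`, the last condition says
that the differential of `f` maps `JX` to `i` times the image of `X`. -/
structure IsCREmbedding (f : ExpGroup ℝ 𝔤 → CSpace n k) : Prop where
  smooth : ContDiff ℝ ∞ (fun a => f (B.chart a))
  immersion : ∀ a, Function.Injective (fderiv ℝ (fun a => f (B.chart a)) a)
  embedding : Topology.IsEmbedding (fun a => f (B.chart a))
  cr : ∀ (p : ExpGroup ℝ 𝔤) (X : S.𝔥), ∃ v : CSpace n k,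
    HasDerivAt (fun t : ℝ => f (p * ExpGroup.exp (t • (X : 𝔤)))) v 0 ∧
    HasDerivAt (fun t : ℝ => f (p * ExpGroup.exp (t • (S.J X : 𝔤)))) (Complex.I • v) 0

/-- `f : G → ℂⁿ⁺ᵏ` has the form `(x + iy, t) ↦ (x + iy + P(x, y), t + Q(x, y, t))` for vectors
`P` and `Q` of complex polynomials. -/
def HasPolynomialForm (f : ExpGroup ℝ 𝔤 → CSpace n k) : Prop :=
  ∃ (P : Fin n → MvPolynomial (Fin n ⊕ Fin n) ℂ)
    (Q : Fin k → MvPolynomial ((Fin n ⊕ Fin n) ⊕ Fin k) ℂ),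
    ∀ (x y : Fin n → ℝ) (t : Fin k → ℝ),
      f (B.chart (x, y, t)) =
        (fun j => (x j : ℂ) + Complex.I * (y j : ℂ) +
            (P j).eval (Sum.elim (fun i => (x i : ℂ)) (fun i => (y i : ℂ))),
          fun l => (t l : ℂ) +
            (Q l).eval (Sum.elim (Sum.elim (fun i => (x i : ℂ)) (fun i => (y i : ℂ)))
              (fun i => (t i : ℂ))))

end HorizontalCRStructure.AdaptedBasis

end

/-! The fibres of Φ are the left cosets of H⁰¹, and everything rests on two transversals to these
cosets. Integrability says that 𝔥⁰¹ is a complex subalgebra. Since 𝔫 is an ideal, 𝔪 = 𝔥¹⁰ + 𝔫_ℂ is a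
complex subalgebra and 𝔮 = 𝔤 + i𝔫 is a real one. Each of them is a linear complement of 𝔥⁰¹ in 𝔤_ℂ.
In a nilpotent group such a decomposition of the Lie algebra gives a unique factorisation with
polynomial factors (`exists_isPolyMap_factor`), so that G_ℂ = M H⁰¹ = Q H⁰¹, where Q = exp 𝔮
contains G.

The first factorisation gives Φ, a polynomial map invariant under right multiplication by H⁰¹. Its
complex derivative in the directions X + iJX therefore vanishes, which is the CR condition.
Normality of exp 𝔫_ℂ makes the 𝔥-components of Φ independent of t. Composing Φ with the second
factorisation identifies M with the group Q. The inverse of Φ on Q is the required right inverse,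
the product is transported from Q, and G becomes a subgroup. The real part of the logarithm of this
inverse is a polynomial left inverse of ι, hence ι is an immersion and a homeomorphism onto its
image.

The group law is given only by Dynkin's formula, so its associativity (`bch_assoc`) has to be
proved. In the free associative algebra modulo long words, the truncated exponential and logarithm
are inverse to each other, and log(exp u · exp v) is visibly associative. Primitivity of this
logarithm for letters u and v identifies it with Dynkin's series (`dynkinNorm_logExpMul`). The
theorem of Dynkin, Specht and Wever (`dynkinNorm_freeLieToWord`) then carries the identity to any
nilpotent Lie algebra, without the embedding of the free Lie algebra into the free associative one.
-/

noncomputable section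

/-! ### Truncated exponential and logarithm as polynomials -/

open Polynomial

/-- The exponential series truncated after degree `N`. -/
def expPoly (K : Type*) [Field K] (N : ℕ) : K[X] :=
  ∑ i ∈ Finset.range (N + 1), C ((i.factorial : K)⁻¹) * X ^ i

/-- The series of `log (1 + X)` truncated after degree `N`. -/
def logPoly (K : Type*) [Field K] (N : ℕ) : K[X] :=
  ∑ m ∈ Finset.Icc 1 N, C ((-1) ^ (m - 1) / (m : K)) * X ^ m

section Identities

variable (K : Type*) [Field K]

lemma logPoly_eq_range (N : ℕ) :
    logPoly K N = ∑ m ∈ Finset.range N, C ((-1) ^ m / ((m + 1 : ℕ) : K)) * X ^ (m + 1) := by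
  rw [logPoly, Finset.range_eq_Ico]
  exact (Finset.sum_Ico_add' (fun m : ℕ => C ((-1) ^ (m - 1) / (m : K)) * X ^ m) 0 N 1).symm

lemma X_dvd_logPoly (N : ℕ) : X ∣ logPoly K N := by
  refine Finset.dvd_sum fun m hm => Dvd.dvd.mul_left (dvd_pow_self _ ?_) _
  have := (Finset.mem_Icc.1 hm).1
  omega

lemma X_dvd_expPoly_sub_one (N : ℕ) : X ∣ expPoly K N - 1 := by
  rw [expPoly, Finset.sum_range_succ']
  simp only [Nat.factorial_zero, Nat.cast_one, inv_one, map_one, pow_zero, mul_one,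
    add_sub_cancel_right]
  exact Finset.dvd_sum fun m _ => Dvd.dvd.mul_left (dvd_pow_self _ m.succ_ne_zero) _

variable [CharZero K]

lemma derivative_expPoly (N : ℕ) :
    derivative (expPoly K N) = expPoly K N - C ((N.factorial : K)⁻¹) * X ^ N := by
  have h : expPoly K N - C ((N.factorial : K)⁻¹) * X ^ N =
      ∑ i ∈ Finset.range N, C ((i.factorial : K)⁻¹) * X ^ i := by
    rw [expPoly, Finset.sum_range_succ, add_sub_cancel_right]
  rw [h, expPoly, derivative_sum, Finset.sum_range_succ']
  simp only [derivative_C_mul, derivative_X_pow, pow_zero, derivative_one, mul_zero, add_zero,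
    Nat.add_sub_cancel]
  refine Finset.sum_congr rfl fun i _ => ?_
  rw [← mul_assoc, ← C_mul]
  congr 2
  have h1 : ((i + 1 : ℕ) : K) ≠ 0 := by exact_mod_cast i.succ_ne_zero
  rw [Nat.factorial_succ, Nat.cast_mul, mul_inv, mul_right_comm, inv_mul_cancel₀ h1, one_mul]

lemma derivative_logPoly (N : ℕ) :
    derivative (logPoly K N) * (1 + X) = 1 - (-X) ^ N := by
  have h : derivative (logPoly K N) = ∑ m ∈ Finset.range N, (-X : K[X]) ^ m := by
    rw [logPoly_eq_range, derivative_sum]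
    refine Finset.sum_congr rfl fun i _ => ?_
    have h1 : ((i + 1 : ℕ) : K) ≠ 0 := by exact_mod_cast i.succ_ne_zero
    rw [derivative_C_mul, derivative_X_pow, ← mul_assoc, ← C_mul, div_mul_cancel₀ _ h1,
      Nat.add_sub_cancel, neg_pow (X : K[X])]
    simp
  have := geom_sum_mul_neg (-X : K[X]) N
  rw [h, ← this]
  ring

/-- Replaces uniqueness for first-order differential equations of formal power series: in
characteristic zero the factors n + 1 can be cancelled, so the coefficients vanish one after
another. -/
lemma coeff_eq_zero_of_recursion {N : ℕ} {H : K[X]} (h0 : H.coeff 0 = 0)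
    (h : ∀ n < N, H.coeff n = 0 → H.coeff (n + 1) * (n + 1) = 0) : X ^ (N + 1) ∣ H := by
  rw [X_pow_dvd_iff]
  intro d hd
  induction d with
  | zero => exact h0
  | succ n ih =>
    have h1 : (n : K) + 1 ≠ 0 := by exact_mod_cast n.succ_ne_zero
    exact (mul_eq_zero.1 (h n (by omega) (ih (by omega)))).resolve_right h1

/-- Since exp' = exp and log'(1 + X) = 1/(1 + X) up to terms of degree N, the derivative of log(exp
X) - X vanishes modulo X ^ N. -/
lemma logPoly_comp_expPoly (N : ℕ) :
    X ^ (N + 1) ∣ (logPoly K N).comp (expPoly K N - 1) - X := by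
  set e := expPoly K N with he
  have hl : (derivative (logPoly K N)).comp (e - 1) * e = 1 - (-(e - 1)) ^ N := by
    have := congrArg (fun p => p.comp (e - 1)) (derivative_logPoly K N)
    simpa using this
  have hd : X ^ N ∣ derivative ((logPoly K N).comp (e - 1) - X) := by
    have : derivative ((logPoly K N).comp (e - 1) - X) = -(-(e - 1)) ^ N -
        (derivative (logPoly K N)).comp (e - 1) * C ((N.factorial : K)⁻¹) * X ^ N := by
      rw [derivative_sub, derivative_comp, derivative_sub, derivative_expPoly, derivative_X,
        derivative_one]
      linear_combination hl
    rw [this]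
    refine dvd_sub ?_ (dvd_mul_left _ _)
    rw [dvd_neg]
    refine pow_dvd_pow_of_dvd ?_ _
    rw [dvd_neg]
    exact X_dvd_expPoly_sub_one K N
  have hX : X ∣ (logPoly K N).comp (e - 1) - X := by
    refine dvd_sub ((X_dvd_expPoly_sub_one K N).trans ?_) dvd_rfl
    obtain ⟨q, hq⟩ := X_dvd_logPoly K N
    rw [hq]
    simp [he]
  refine coeff_eq_zero_of_recursion K (X_dvd_iff.1 hX) fun n hn _ => ?_
  rw [← coeff_derivative]
  exact X_pow_dvd_iff.1 hd n hn

/-- Both exp(log(1 + X)) and 1 + X solve H'(1 + X) = H up to terms of degree N, and they have the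
same constant term. -/
lemma expPoly_comp_logPoly (N : ℕ) :
    X ^ (N + 1) ∣ (expPoly K N).comp (logPoly K N) - (1 + X) := by
  set l := logPoly K N with hl
  set H := (expPoly K N).comp l - (1 + X) with hH
  have hd : X ^ N ∣ derivative H * (1 + X) - H := by
    have : derivative H * (1 + X) - H = -(-X) ^ N * (expPoly K N).comp l -
        C ((N.factorial : K)⁻¹) * l ^ N * (1 - (-X) ^ N) := by
      rw [hH, derivative_sub, derivative_comp, derivative_expPoly, derivative_add, derivative_X,
        derivative_one]
      have := derivative_logPoly K N
      rw [← hl] at this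
      simp only [sub_comp, mul_comp, C_comp, pow_comp, X_comp]
      linear_combination ((expPoly K N).comp l - C ((N.factorial : K)⁻¹) * l ^ N) * this
    rw [this]
    refine dvd_sub (Dvd.dvd.mul_right ?_ _) (Dvd.dvd.mul_right (Dvd.dvd.mul_left ?_ _) _)
    · rw [dvd_neg]
      exact pow_dvd_pow_of_dvd ((dvd_neg).2 dvd_rfl) _
    · exact pow_dvd_pow_of_dvd (X_dvd_logPoly K N) _
  have hX : X ∣ H := by
    have h1 : X ∣ (expPoly K N).comp l - 1 := by
      refine (X_dvd_logPoly K N).trans ?_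
      obtain ⟨q, hq⟩ := X_dvd_expPoly_sub_one K N
      have : (expPoly K N).comp l - 1 = (expPoly K N - 1).comp l := by simp
      rw [this, hq]
      simp [hl]
    rw [hH, ← sub_sub]
    exact dvd_sub h1 dvd_rfl
  refine coeff_eq_zero_of_recursion K (X_dvd_iff.1 hX) fun n hn h0 => ?_
  have h1 := X_pow_dvd_iff.1 hd n hn
  rw [mul_add, mul_one, coeff_sub, coeff_add, coeff_derivative, h0, sub_zero] at h1
  cases n with
  | zero => simpa using h1
  | succ m => rwa [coeff_mul_X, coeff_derivative, h0, zero_mul, add_zero] at h1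

end Identities

/-! ### Exponential and logarithm at nilpotent elements -/

section Algebra

variable {K : Type*} [Field K] {A : Type*} [Ring A] [Algebra K A]

lemma aeval_eq_of_dvd {N : ℕ} {w : A} (hw : w ^ (N + 1) = 0) {p q : K[X]}
    (h : X ^ (N + 1) ∣ p - q) : aeval w p = aeval w q := by
  obtain ⟨r, hr⟩ := h
  rw [← sub_eq_zero, ← map_sub, hr]
  simp [hw]

lemma exists_aeval_logPoly_eq (N : ℕ) (w : A) :
    ∃ q : K[X], aeval w (logPoly K N) = w * aeval w q := by
  obtain ⟨q, hq⟩ := X_dvd_logPoly K N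
  exact ⟨q, by rw [hq]; simp⟩

lemma exists_aeval_expPoly_sub_one_eq (N : ℕ) (w : A) :
    ∃ q : K[X], aeval w (expPoly K N) - 1 = w * aeval w q := by
  obtain ⟨q, hq⟩ := X_dvd_expPoly_sub_one K N
  refine ⟨q, ?_⟩
  have := congrArg (aeval w) hq
  simpa using this

lemma mul_aeval_pow_eq_zero {N : ℕ} {w : A} (hw : w ^ (N + 1) = 0) (q : K[X]) :
    (w * aeval w q) ^ (N + 1) = 0 := by
  have : w * aeval w q = aeval w (X * q) := by simp
  rw [this, ← map_pow, mul_pow]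
  simp [hw]

lemma logPoly_pow_eq_zero {N M : ℕ} {w : A} (hw : w ^ (N + 1) = 0) :
    aeval w (logPoly K M) ^ (N + 1) = 0 := by
  obtain ⟨q, hq⟩ := exists_aeval_logPoly_eq (K := K) M w
  rw [hq, mul_aeval_pow_eq_zero hw]

lemma aeval_expPoly_eq_of_le {N M : ℕ} (h : N ≤ M) {w : A} (hw : w ^ (N + 1) = 0) :
    aeval w (expPoly K M) = aeval w (expPoly K N) := by
  refine aeval_eq_of_dvd hw ?_
  rw [expPoly, expPoly, ← Finset.sum_range_add_sum_Ico _ (by omega : N + 1 ≤ M + 1),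
    add_sub_cancel_left]
  exact Finset.dvd_sum fun m hm => Dvd.dvd.mul_left (pow_dvd_pow _ (Finset.mem_Ico.1 hm).1) _

lemma aeval_logPoly_eq_of_le {N M : ℕ} (h : N ≤ M) {w : A} (hw : w ^ (N + 1) = 0) :
    aeval w (logPoly K M) = aeval w (logPoly K N) := by
  refine aeval_eq_of_dvd hw ?_
  rw [logPoly_eq_range, logPoly_eq_range, ← Finset.sum_range_add_sum_Ico _ h,
    add_sub_cancel_left]
  refine Finset.dvd_sum fun m hm => Dvd.dvd.mul_left (pow_dvd_pow _ ?_) _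
  have := (Finset.mem_Ico.1 hm).1
  omega

variable [CharZero K]

lemma exp_log {N : ℕ} {w : A} (hw : w ^ (N + 1) = 0) :
    aeval (aeval w (logPoly K N)) (expPoly K N) = 1 + w := by
  rw [← aeval_comp, aeval_eq_of_dvd hw (expPoly_comp_logPoly K N)]
  simp

lemma log_exp {N : ℕ} {w : A} (hw : w ^ (N + 1) = 0) :
    aeval (aeval w (expPoly K N) - 1) (logPoly K N) = w := by
  have : aeval w (expPoly K N) - 1 = aeval w (expPoly K N - 1) := by simp
  rw [this, ← aeval_comp, aeval_eq_of_dvd hw (logPoly_comp_expPoly K N)]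
  simp

lemma aeval_expPoly_add {N : ℕ} {a b : A} (hab : Commute a b) (ha : a ^ (N + 1) = 0)
    (hb : b ^ (N + 1) = 0) (h : (a + b) ^ (N + 1) = 0) :
    aeval (a + b) (expPoly K N) = aeval a (expPoly K N) * aeval b (expPoly K N) := by
  -- `IsNilpotent.exp` needs rational scalars; they act through ℚ → K, which exists in
  -- characteristic zero.
  let _ : Module ℚ A := Module.compHom A (algebraMap ℚ K)
  have key : ∀ w : A, w ^ (N + 1) = 0 → aeval w (expPoly K N) = IsNilpotent.exp w := by
    intro w hw
    rw [IsNilpotent.exp_eq_sum hw, expPoly, map_sum]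
    refine Finset.sum_congr rfl fun i _ => ?_
    rw [map_mul, aeval_C, map_pow, aeval_X, ← Algebra.smul_def]
    change _ = (algebraMap ℚ K (i.factorial : ℚ)⁻¹) • w ^ i
    simp
  rw [key _ ha, key _ hb, key _ h]
  exact IsNilpotent.exp_add_of_commute hab ⟨_, ha⟩ ⟨_, hb⟩

/-- `log (g g') = log g + log g'` for commuting unipotent `g` and `g'`. -/
lemma log_mul_of_commute {k N : ℕ} (hN : 2 * k ≤ N) {w v : A} (hwv : Commute w v)
    (hw : w ^ (k + 1) = 0) (hv : v ^ (k + 1) = 0) :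
    aeval ((1 + w) * (1 + v) - 1) (logPoly K N) =
      aeval w (logPoly K N) + aeval v (logPoly K N) := by
  have hcomm : Commute (aeval w (logPoly K N)) (aeval v (logPoly K N)) := by
    have h1 : ∀ (p : K[X]) {a b : A}, Commute a b → Commute (aeval a p) b := by
      intro p a b hab
      induction p using Polynomial.induction_on' with
      | add p q hp hq => rw [map_add]; exact hp.add_left hq
      | monomial n c =>
        rw [aeval_monomial]
        exact (show Commute (algebraMap K A c) b from Algebra.commutes c b).mul_left (hab.pow_left n)
    exact h1 _ (h1 _ hwv.symm).symm
  have hle : k + 1 ≤ N + 1 := by omega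
  have e1 := exp_log (K := K) (pow_eq_zero_of_le hle hw)
  have e2 := exp_log (K := K) (pow_eq_zero_of_le hle hv)
  have h1 := logPoly_pow_eq_zero (K := K) (M := N) hw
  have h2 := logPoly_pow_eq_zero (K := K) (M := N) hv
  -- By the binomial theorem, two commuting elements with vanishing (k+1)-st power have a sum with
  -- vanishing (2k+1)-st power, hence the bound 2k ≤ N.
  have h3 : (aeval w (logPoly K N) + aeval v (logPoly K N)) ^ (N + 1) = 0 :=
    pow_eq_zero_of_le (by omega : 2 * k + 1 ≤ N + 1)
      (hcomm.add_pow_eq_zero_of_add_le_succ_of_pow_eq_zero h1 h2 (by omega))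
  rw [← e1, ← e2, ← aeval_expPoly_add hcomm (pow_eq_zero_of_le hle h1)
    (pow_eq_zero_of_le hle h2) h3, log_exp h3]

end Algebra

end

noncomputable section

/-! ### Nested brackets and the truncated Dynkin series -/

section NestedBracket

lemma nestedBracket_cons {L : Type*} [LieRing L] (a : L) {l : List L} (hl : l ≠ []) :
    nestedBracket (a :: l) = ⁅a, nestedBracket l⁆ := by
  cases l with
  | nil => exact absurd rfl hl
  | cons b l => rfl

lemma LieHom.map_nestedBracket {K L L' : Type*} [CommRing K] [LieRing L] [LieAlgebra K L]
    [LieRing L'] [LieAlgebra K L'] (f : L →ₗ⁅K⁆ L') (l : List L) :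
    f (nestedBracket l) = nestedBracket (l.map f) := by
  induction l with
  | nil => simp [nestedBracket]
  | cons a l ih =>
    rcases eq_or_ne l [] with rfl | hl
    · simp [nestedBracket]
    · rw [nestedBracket_cons a hl, List.map_cons, nestedBracket_cons _ (by simpa using hl),
        LieHom.map_lie, ih]

/-- Dynkin's series, truncated at `N`. -/
def bchTrunc (K : Type*) {L : Type*} [Field K] [LieRing L] [LieAlgebra K L] (N : ℕ) (x y : L) :
    L :=
  ∑ m ∈ Finset.Icc 1 N,
    ∑ p ∈ Fintype.piFinset (fun _ : Fin m =>
        ((Finset.range (N + 1)) ×ˢ (Finset.range (N + 1))).filter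
            (fun rs : ℕ × ℕ => 0 < rs.1 + rs.2)),
      ((-1 : K) ^ (m - 1) / (m : K) * ((∑ i, ((p i).1 + (p i).2) : ℕ) : K)⁻¹ *
          ∏ i, (((p i).1.factorial * (p i).2.factorial : ℕ) : K)⁻¹) •
        nestedBracket (List.ofFn fun i =>
          List.replicate (p i).1 x ++ List.replicate (p i).2 y).flatten

variable {K L : Type*} [Field K] [LieRing L] [LieAlgebra K L]

lemma bch_eq_bchTrunc (x y : L) :
    bch K x y = bchTrunc K (LieModule.nilpotencyLength L L) x y := rfl

lemma LieHom.map_bchTrunc {L' : Type*} [LieRing L'] [LieAlgebra K L'] (f : L →ₗ⁅K⁆ L') (N : ℕ)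
    (x y : L) : f (bchTrunc K N x y) = bchTrunc K N (f x) (f y) := by
  simp only [bchTrunc, map_sum, map_smul, LieHom.map_nestedBracket, List.map_flatten,
    List.map_ofFn, Function.comp_def, List.map_append, List.map_replicate]

end NestedBracket

/-! ### The free associative algebra -/

/-- The free associative algebra on the letters `X`. -/
abbrev WordAlg (K X : Type*) [Field K] : Type _ := MonoidAlgebra K (FreeMonoid X)

namespace WordAlg

variable {K X V : Type*} [Field K] [AddCommGroup V] [Module K V]

/-- The basis element of a word. -/
def word (K : Type*) [Field K] (w : List X) : WordAlg K X :=
  MonoidAlgebra.single (FreeMonoid.ofList w) 1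

lemma word_mul (u v : List X) : word K u * word K v = word K (u ++ v) := by
  simp [word, MonoidAlgebra.single_mul_single]

lemma word_nil : word K ([] : List X) = 1 := rfl

lemma word_cons (a : X) (w : List X) : word K (a :: w) = word K [a] * word K w := by
  rw [word_mul]; rfl

lemma word_single_pow (a : X) (r : ℕ) : word K [a] ^ r = word K (List.replicate r a) := by
  induction r with
  | zero => rfl
  | succ r ih => rw [pow_succ', ih, List.replicate_succ, ← word_cons]

@[elab_as_elim]
lemma induction_word {p : WordAlg K X → Prop} (f : WordAlg K X) (hw : ∀ w, p (word K w))
    (hadd : ∀ f g, p f → p g → p (f + g)) (hsmul : ∀ (c : K) f, p f → p (c • f)) : p f := by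
  refine MonoidAlgebra.induction_linear f ?_ hadd fun m r => ?_
  · have := hsmul 0 _ (hw [])
    rwa [zero_smul] at this
  · have := hsmul r _ (hw m.toList)
    rwa [word, MonoidAlgebra.smul_single, smul_eq_mul, mul_one] at this

/-- The linear map with prescribed values on words. -/
def wordMap (f : List X → V) : WordAlg K X →ₗ[K] V :=
  (Finsupp.linearCombination K fun w : FreeMonoid X => f w.toList) ∘ₗ
    (MonoidAlgebra.coeffLinearEquiv K).toLinearMap

@[simp]
lemma wordMap_word (f : List X → V) (w : List X) : wordMap f (word K w) = f w := by
  simp [wordMap, word]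

/-- The algebra homomorphism with prescribed values on letters. -/
def liftAlg {A : Type*} [Ring A] [Algebra K A] (f : X → A) : WordAlg K X →ₐ[K] A :=
  MonoidAlgebra.lift K A (FreeMonoid X) (FreeMonoid.lift f)

@[simp]
lemma liftAlg_word {A : Type*} [Ring A] [Algebra K A] (f : X → A) (w : List X) :
    liftAlg f (word K w) = (w.map f).prod := by
  simp [liftAlg, word, FreeMonoid.lift_apply]

/-- The counit, which kills all letters. -/
def counit : WordAlg K X →ₐ[K] K := liftAlg fun _ => 0

lemma counit_word {w : List X} (hw : w ≠ []) : counit (word K w) = 0 := by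
  cases w with
  | nil => exact absurd rfl hw
  | cons a w => simp [counit]

/-- The span of the words of length at least `k`. -/
def filt (K X : Type*) [Field K] (k : ℕ) : Submodule K (WordAlg K X) :=
  Submodule.span K (word K '' {w | k ≤ w.length})

lemma word_mem_filt {k : ℕ} {w : List X} (h : k ≤ w.length) : word K w ∈ filt K X k :=
  Submodule.subset_span ⟨w, h, rfl⟩

lemma mul_mem_filt {j k : ℕ} {f g : WordAlg K X} (hf : f ∈ filt K X j) (hg : g ∈ filt K X k) :
    f * g ∈ filt K X (j + k) := by
  have : f * g ∈ filt K X j * filt K X k := Submodule.mul_mem_mul hf hg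
  refine (?_ : filt K X j * filt K X k ≤ _) this
  rw [filt, filt, Submodule.span_mul_span]
  refine Submodule.span_le.2 ?_
  rintro _ ⟨_, ⟨u, hu, rfl⟩, _, ⟨v, hv, rfl⟩, rfl⟩
  simp only [Set.mem_ofPred_eq] at hu hv
  rw [SetLike.mem_coe]
  beta_reduce
  rw [word_mul]
  exact word_mem_filt (by rw [List.length_append]; omega)

lemma filt_zero : filt K X 0 = ⊤ := by
  refine eq_top_iff.2 fun f _ => ?_
  induction f using induction_word with
  | hw w => exact word_mem_filt (Nat.zero_le _)
  | hadd f g hf hg => exact add_mem (hf trivial) (hg trivial)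
  | hsmul c f hf => exact Submodule.smul_mem _ _ (hf trivial)

lemma sub_counit_mem_filt (f : WordAlg K X) : f - algebraMap K _ (counit f) ∈ filt K X 1 := by
  induction f using induction_word with
  | hw w =>
    rcases eq_or_ne w [] with rfl | hw
    · simp only [word_nil, map_one, sub_self, zero_mem]
    · rw [counit_word hw, map_zero, sub_zero]
      exact word_mem_filt (List.length_pos_iff.2 hw)
  | hadd f g hf hg =>
    have := add_mem hf hg
    simp only [map_add]
    convert this using 1
    abel
  | hsmul c f hf =>
    have := Submodule.smul_mem _ c hf
    rw [map_smul, smul_eq_mul, map_mul, ← Algebra.smul_def, ← smul_sub]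
    exact this

/-- The span of the words of length `k`. -/
def homog (K X : Type*) [Field K] (k : ℕ) : Submodule K (WordAlg K X) :=
  Submodule.span K (word K '' {w | w.length = k})

lemma word_mem_homog (w : List X) : word K w ∈ homog K X w.length :=
  Submodule.subset_span ⟨w, rfl, rfl⟩

lemma mul_mem_homog {j k : ℕ} {f g : WordAlg K X} (hf : f ∈ homog K X j)
    (hg : g ∈ homog K X k) : f * g ∈ homog K X (j + k) := by
  have : f * g ∈ homog K X j * homog K X k := Submodule.mul_mem_mul hf hg
  refine (?_ : homog K X j * homog K X k ≤ _) this
  rw [homog, homog, Submodule.span_mul_span]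
  refine Submodule.span_le.2 ?_
  rintro _ ⟨_, ⟨u, hu, rfl⟩, _, ⟨v, hv, rfl⟩, rfl⟩
  simp only [Set.mem_ofPred_eq] at hu hv
  rw [SetLike.mem_coe]
  beta_reduce
  rw [word_mul, ← hu, ← hv, ← List.length_append]
  exact word_mem_homog _

lemma homog_le_filt (k : ℕ) : homog K X k ≤ filt K X k :=
  Submodule.span_mono (Set.image_mono fun _ h => le_of_eq (Eq.symm h))

/-- The two-sided ideal spanned by the words of length more than `N`. -/
def longIdeal (K X : Type*) [Field K] (N : ℕ) : Ideal (WordAlg K X) where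
  carrier := filt K X (N + 1)
  add_mem' := add_mem
  zero_mem' := zero_mem _
  smul_mem' f g hg := by
    have := mul_mem_filt (filt_zero (K := K) (X := X) ▸ Submodule.mem_top (x := f)) hg
    rwa [Nat.zero_add] at this

instance (N : ℕ) : (longIdeal K X N).IsTwoSided where
  mul_mem_of_left {f} g hf := by
    have := mul_mem_filt hf (filt_zero (K := K) (X := X) ▸ Submodule.mem_top (x := g))
    rwa [Nat.add_zero] at this

end WordAlg

/-! ### The truncated free associative algebra -/

open WordAlg

/-- The free associative algebra modulo the words of length more than `N`. -/
def TruncAlg (K X : Type*) [Field K] (N : ℕ) : Type _ := WordAlg K X ⧸ longIdeal K X N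

namespace TruncAlg

variable {K X V : Type*} [Field K] [AddCommGroup V] [Module K V] {N : ℕ}

instance : Ring (TruncAlg K X N) := inferInstanceAs (Ring (WordAlg K X ⧸ longIdeal K X N))

instance : Algebra K (TruncAlg K X N) :=
  inferInstanceAs (Algebra K (WordAlg K X ⧸ longIdeal K X N))

/-- The quotient map. -/
def mk (K X : Type*) [Field K] (N : ℕ) : WordAlg K X →ₐ[K] TruncAlg K X N :=
  Ideal.Quotient.mkₐ K (longIdeal K X N)

lemma mk_surjective : Function.Surjective (mk K X N) := Ideal.Quotient.mkₐ_surjective K _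

lemma mk_eq_zero_iff {f : WordAlg K X} : mk K X N f = 0 ↔ f ∈ filt K X (N + 1) :=
  Ideal.Quotient.eq_zero_iff_mem

/-- A linear map that kills long words descends to the truncated algebra. -/
def desc (f : WordAlg K X →ₗ[K] V) (hf : ∀ w : List X, N < w.length → f (word K w) = 0) :
    TruncAlg K X N →ₗ[K] V where
  toFun := Quotient.lift f (by
    intro a b hab
    have h1 : a - b ∈ filt K X (N + 1) := (Submodule.quotientRel_def _).1 hab
    have h2 : filt K X (N + 1) ≤ LinearMap.ker f := by
      refine Submodule.span_le.2 ?_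
      rintro _ ⟨w, hw, rfl⟩
      exact hf w hw
    have h3 := LinearMap.mem_ker.1 (h2 h1)
    rwa [map_sub, sub_eq_zero] at h3)
  map_add' a b := by
    obtain ⟨a, rfl⟩ := mk_surjective a
    obtain ⟨b, rfl⟩ := mk_surjective b
    exact map_add f a b
  map_smul' c a := by
    obtain ⟨a, rfl⟩ := mk_surjective a
    exact map_smul f c a

@[simp]
lemma desc_mk (f : WordAlg K X →ₗ[K] V) (hf : ∀ w : List X, N < w.length → f (word K w) = 0)
    (P : WordAlg K X) : desc f hf (mk K X N P) = f P := rfl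

/-- An algebra homomorphism that kills long words descends to the truncated algebra. -/
def descAlg {A : Type*} [Ring A] [Algebra K A] (f : WordAlg K X →ₐ[K] A)
    (hf : ∀ w : List X, N < w.length → f (word K w) = 0) : TruncAlg K X N →ₐ[K] A :=
  AlgHom.ofLinearMap (desc f.toLinearMap fun w hw => hf w hw)
    (by
      change f 1 = 1
      rw [map_one])
    (fun a b => by
      obtain ⟨a, rfl⟩ := mk_surjective a
      obtain ⟨b, rfl⟩ := mk_surjective b
      rw [← map_mul]
      change f (a * b) = f a * f b
      rw [map_mul])

@[simp]
lemma descAlg_mk {A : Type*} [Ring A] [Algebra K A] (f : WordAlg K X →ₐ[K] A)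
    (hf : ∀ w : List X, N < w.length → f (word K w) = 0) (P : WordAlg K X) :
    descAlg f hf (mk K X N P) = f P := rfl

/-- The counit of the truncated algebra. -/
def counit : TruncAlg K X N →ₐ[K] K :=
  descAlg WordAlg.counit fun w hw => counit_word (by rintro rfl; simp at hw)

@[simp]
lemma counit_mk (P : WordAlg K X) : counit (mk K X N P) = WordAlg.counit P := rfl

lemma exists_mem_filt_of_counit {b : TruncAlg K X N} (hb : counit b = 0) :
    ∃ f ∈ filt K X 1, mk K X N f = b := by
  obtain ⟨f, rfl⟩ := mk_surjective b
  refine ⟨_, sub_counit_mem_filt f, ?_⟩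
  rw [counit_mk] at hb
  rw [hb, map_zero, sub_zero]

lemma exists_mem_filt_prod {l : List (TruncAlg K X N)} (hl : ∀ b ∈ l, counit b = 0) :
    ∃ f ∈ filt K X l.length, mk K X N f = l.prod := by
  induction l with
  | nil => exact ⟨1, word_mem_filt (w := []) le_rfl, by simp⟩
  | cons b l ih =>
    obtain ⟨f, hf, hfl⟩ := ih fun c hc => hl c (List.mem_cons_of_mem _ hc)
    obtain ⟨g, hg, hgb⟩ := exists_mem_filt_of_counit (hl b List.mem_cons_self)
    refine ⟨g * f, ?_, by rw [map_mul, hfl, hgb, List.prod_cons]⟩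
    rw [List.length_cons, add_comm]
    exact mul_mem_filt hg hf

/-- Each factor without constant term raises the minimal word length by one. The augmentation ideal
is thus nilpotent, and truncated series lose nothing on it. -/
lemma prod_eq_zero {l : List (TruncAlg K X N)} (hl : ∀ b ∈ l, counit b = 0)
    (h : N < l.length) : l.prod = 0 := by
  obtain ⟨f, hf, hfl⟩ := exists_mem_filt_prod hl
  rw [← hfl, mk_eq_zero_iff]
  exact Submodule.span_mono (Set.image_mono fun w (hw : _ ≤ _) => h.trans_le hw) hf

lemma pow_eq_zero_of_counit {b : TruncAlg K X N} (hb : counit b = 0) : b ^ (N + 1) = 0 := by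
  rw [← List.prod_replicate]
  exact prod_eq_zero (fun c hc => by rwa [List.eq_of_mem_replicate hc]) (by simp)

end TruncAlg

end

noncomputable section

attribute [local instance] LieRing.ofAssociativeRing

open WordAlg

/-! ### The Dynkin operator and the theorem of Dynkin, Specht and Wever -/

section Dynkin

variable {K X L : Type*} [Field K] [LieRing L] [LieAlgebra K L] (φ : X → L)

/-- The Dynkin operator: it sends a word to its nested bracket in `L`. -/
def dynkin : WordAlg K X →ₗ[K] L := wordMap fun w => nestedBracket (w.map φ)

/-- The Dynkin operator divided by the length of words. -/
def dynkinNorm : WordAlg K X →ₗ[K] L :=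
  wordMap fun w => (w.length : K)⁻¹ • nestedBracket (w.map φ)

/-- The extension of the adjoint action of the letters to the free associative algebra. -/
def adHom : WordAlg K X →ₐ[K] Module.End K L := liftAlg fun x => LieAlgebra.ad K L (φ x)

/-- The empty bracket is 0, so D(aw) = [a, D(w)] fails only for the empty word, where D(a) = a; the
counit term corrects this. -/
lemma dynkin_letter_mul (a : X) (P : WordAlg K X) :
    dynkin φ (word K [a] * P) = ⁅φ a, dynkin φ P⁆ + WordAlg.counit P • φ a := by
  induction P using WordAlg.induction_word with
  | hw w =>
    rw [← word_cons]
    rcases eq_or_ne w [] with rfl | hw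
    · have h1 : dynkin φ (1 : WordAlg K X) = 0 := by
        rw [← word_nil]
        simp [dynkin, nestedBracket]
      rw [word_nil, h1, map_one, one_smul, lie_zero, zero_add]
      simp [dynkin, nestedBracket]
    · rw [counit_word hw, zero_smul, add_zero]
      simp only [dynkin, wordMap_word, List.map_cons]
      exact nestedBracket_cons _ (by simpa using hw)
  | hadd P Q hP hQ =>
    simp only [mul_add, map_add, hP, hQ, lie_add, add_smul]
    abel
  | hsmul c P hP =>
    rw [Algebra.mul_smul_comm, map_smul, hP, map_smul, map_smul, lie_smul, smul_add, smul_assoc]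

/-- A nested bracket is the successive adjoint action of its earlier letters on the last one. -/
lemma dynkin_mul_letter (P : WordAlg K X) (a : X) :
    dynkin φ (P * word K [a]) = adHom φ P (φ a) := by
  induction P using WordAlg.induction_word with
  | hw w =>
    rw [word_mul]
    induction w with
    | nil => simp [dynkin, adHom, nestedBracket]
    | cons b w ih =>
      have : dynkin φ (word K (b :: w ++ [a])) = ⁅φ b, dynkin φ (word K (w ++ [a]))⁆ := by
        simp only [dynkin, wordMap_word, List.cons_append, List.map_cons]
        exact nestedBracket_cons _ (by simp)
      rw [this, ih]
      simp [adHom]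
  | hadd P Q hP hQ => simp only [add_mul, map_add, hP, hQ, LinearMap.add_apply]
  | hsmul c P hP =>
    rw [Algebra.smul_mul_assoc, map_smul, hP, map_smul, LinearMap.smul_apply]

lemma dynkinNorm_of_mem_homog {k : ℕ} {P : WordAlg K X} (hP : P ∈ homog K X k) :
    dynkinNorm φ P = (k : K)⁻¹ • dynkin φ P := by
  induction hP using Submodule.span_induction with
  | mem P h =>
    obtain ⟨w, rfl, rfl⟩ := h
    simp [dynkin, dynkinNorm]
  | zero => simp
  | add P Q _ _ hP hQ => rw [map_add, map_add, hP, hQ, smul_add]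
  | smul c P _ hP => rw [map_smul, map_smul, hP, smul_comm]

variable (K X) in
/-- The canonical map of the free Lie algebra to the free associative algebra. -/
def freeLieToWord : FreeLieAlgebra K X →ₗ⁅K⁆ WordAlg K X :=
  FreeLieAlgebra.lift K fun a => word K [a]

lemma freeLieToWord_nestedBracket (w : List X) :
    freeLieToWord K X (nestedBracket (w.map (FreeLieAlgebra.of K))) =
      nestedBracket (w.map fun a => word K [a]) := by
  rw [LieHom.map_nestedBracket, List.map_map]
  congr 2
  funext a
  simp [freeLieToWord]

lemma nestedBracket_letters_mem_homog (w : List X) :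
    nestedBracket (w.map fun a => word K [a]) ∈ homog K X w.length := by
  induction w with
  | nil => exact zero_mem _
  | cons a w ih =>
    rcases eq_or_ne w [] with rfl | hw
    · exact word_mem_homog [a]
    · rw [List.map_cons, nestedBracket_cons _ (by simpa using hw), Ring.lie_def, List.length_cons]
      refine sub_mem ?_ (mul_mem_homog ih (word_mem_homog [a]))
      rw [add_comm]
      exact mul_mem_homog (word_mem_homog [a]) ih

lemma counit_nestedBracket_letters (w : List X) :
    WordAlg.counit (nestedBracket (w.map fun a => word K [a])) = 0 := by
  cases w with
  | nil => simp [nestedBracket]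
  | cons a w =>
    rcases eq_or_ne w [] with rfl | hw
    · exact counit_word (by simp)
    · rw [List.map_cons, nestedBracket_cons _ (by simpa using hw), Ring.lie_def, map_sub, map_mul,
        map_mul, mul_comm, sub_self]

/-- Two Lie homomorphisms into End L agree on generators. Together with `dynkin_mul_letter` this
gives D(Wa) = [W, a] for a Lie element W. -/
lemma adHom_freeLieToWord (W : FreeLieAlgebra K X) :
    adHom φ (freeLieToWord K X W) = LieAlgebra.ad K L (FreeLieAlgebra.lift K φ W) := by
  have : (adHom (K := K) φ).toLieHom.comp (freeLieToWord K X) =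
      (LieAlgebra.ad K L).comp (FreeLieAlgebra.lift K φ) := by
    refine FreeLieAlgebra.hom_ext fun a => ?_
    simp [freeLieToWord, adHom]
  exact LieHom.congr_fun this W

/-- Induction on the length: for a Lie element W of degree n, D(aW - Wa) = [a, D(W)] - [W, a] = (n +
1)[a, W]. -/
lemma dynkin_freeLieToWord_nestedBracket (w : List X) :
    dynkin φ (freeLieToWord K X (nestedBracket (w.map (FreeLieAlgebra.of K)))) =
      (w.length : K) • FreeLieAlgebra.lift K φ (nestedBracket (w.map (FreeLieAlgebra.of K))) := by
  induction w with
  | nil => simp [nestedBracket]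
  | cons a w ih =>
    rcases eq_or_ne w [] with rfl | hw
    · simp [nestedBracket, freeLieToWord, dynkin]
    · rw [List.map_cons, nestedBracket_cons _ (by simpa using hw), LieHom.map_lie, Ring.lie_def,
        map_sub]
      have h1 : freeLieToWord K X (FreeLieAlgebra.of K a) = word K [a] := by simp [freeLieToWord]
      rw [h1, dynkin_letter_mul, dynkin_mul_letter, adHom_freeLieToWord, ih,
        freeLieToWord_nestedBracket, counit_nestedBracket_letters, zero_smul, add_zero,
        LieAlgebra.ad_apply, LieHom.map_lie, FreeLieAlgebra.lift_of_apply, lie_smul,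
        ← lie_skew _ (φ a), sub_neg_eq_add, List.length_cons, Nat.cast_add, Nat.cast_one, add_smul, one_smul]

/-- A subalgebra of the free Lie algebra that contains the generators is everything. -/
lemma FreeLieAlgebra.mem_of_forall_of_mem (S : LieSubalgebra K (FreeLieAlgebra K X))
    (h : ∀ a, FreeLieAlgebra.of K a ∈ S) (W : FreeLieAlgebra K X) : W ∈ S := by
  let f : FreeLieAlgebra K X →ₗ⁅K⁆ S := FreeLieAlgebra.lift K fun a => ⟨FreeLieAlgebra.of K a, h a⟩
  have : S.incl.comp f = LieHom.id := by
    refine FreeLieAlgebra.hom_ext fun a => ?_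
    simp [f]
  have := LieHom.congr_fun this W
  rw [LieHom.id_apply] at this
  rw [← this]
  exact (f W).2

variable (K X) in
/-- The span of the nested brackets of generators. -/
def nestedSpan : Submodule K (FreeLieAlgebra K X) :=
  Submodule.span K (Set.range fun w : List X => nestedBracket (w.map (FreeLieAlgebra.of K)))

/-- By the Jacobi identity, the elements whose bracket preserves the span form a subalgebra. It
contains the generators and is therefore everything, so the span is itself a subalgebra. -/
lemma nestedSpan_eq_top : nestedSpan K X = ⊤ := by
  have hmem : ∀ w : List X, nestedBracket (w.map (FreeLieAlgebra.of K)) ∈ nestedSpan K X :=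
    fun w => Submodule.subset_span ⟨w, rfl⟩
  let S : LieSubalgebra K (FreeLieAlgebra K X) :=
    { carrier := {W | ∀ Z ∈ nestedSpan K X, ⁅W, Z⁆ ∈ nestedSpan K X}
      add_mem' := fun {W W'} h h' Z hZ => by
        rw [add_lie]; exact add_mem (h Z hZ) (h' Z hZ)
      zero_mem' := fun Z _ => by rw [zero_lie]; exact zero_mem _
      smul_mem' := fun c W h Z hZ => by
        rw [smul_lie]; exact Submodule.smul_mem _ _ (h Z hZ)
      lie_mem' := fun {W W'} h h' Z hZ => by
        rw [lie_lie]; exact sub_mem (h _ (h' Z hZ)) (h' _ (h Z hZ)) }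
  have hS : ∀ W, W ∈ S := by
    refine FreeLieAlgebra.mem_of_forall_of_mem S fun a Z hZ => ?_
    induction hZ using Submodule.span_induction with
    | mem Z h =>
      obtain ⟨w, rfl⟩ := h
      rcases eq_or_ne w [] with rfl | hw
      · simp [nestedBracket]
      · have := hmem (a :: w)
        rwa [List.map_cons, nestedBracket_cons _ (by simpa using hw)] at this
    | zero => simp
    | add Y Z _ _ hY hZ => rw [lie_add]; exact add_mem hY hZ
    | smul c Z _ hZ => rw [lie_smul]; exact Submodule.smul_mem _ _ hZ
  let S' : LieSubalgebra K (FreeLieAlgebra K X) :=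
    { nestedSpan K X with lie_mem' := fun {W Z} _ hZ => hS W Z hZ }
  exact eq_top_iff.2 fun W _ =>
    FreeLieAlgebra.mem_of_forall_of_mem S' (fun a => hmem [a]) W

variable [CharZero K]

/-- The theorem of Dynkin, Specht and Wever. -/
lemma dynkinNorm_freeLieToWord (W : FreeLieAlgebra K X) :
    dynkinNorm φ (freeLieToWord K X W) = FreeLieAlgebra.lift K φ W := by
  have hW : W ∈ nestedSpan K X := nestedSpan_eq_top (K := K) (X := X) ▸ Submodule.mem_top
  induction hW using Submodule.span_induction with
  | mem W h =>
    obtain ⟨w, rfl⟩ := h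
    have h1 := nestedBracket_letters_mem_homog (K := K) w
    rw [← freeLieToWord_nestedBracket] at h1
    beta_reduce
    rw [dynkinNorm_of_mem_homog φ h1, dynkin_freeLieToWord_nestedBracket]
    rcases eq_or_ne w [] with rfl | hw
    · simp [nestedBracket]
    · have : (w.length : K) ≠ 0 := by exact_mod_cast (List.length_pos_iff.2 hw).ne'
      rw [inv_smul_smul₀ this]
  | zero => simp
  | add W Z _ _ hW hZ => simp only [map_add, hW, hZ]
  | smul c W _ hW => simp only [map_smul, hW]

end Dynkin

/-! ### Friedrichs' theorem for `log (exp x * exp y)` -/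

section Friedrichs

open Polynomial

/-- `log (exp u * exp v)`, with truncated series. -/
def logExpMul (K : Type*) [Field K] {A : Type*} [Ring A] [Algebra K A] (M : ℕ) (u v : A) : A :=
  aeval (aeval u (expPoly K M) * aeval v (expPoly K M) - 1) (logPoly K M)

lemma AlgHom.map_logExpMul {K : Type*} [Field K] {A A' : Type*} [Ring A] [Algebra K A] [Ring A']
    [Algebra K A'] (f : A →ₐ[K] A') (M : ℕ) (u v : A) :
    f (logExpMul K M u v) = logExpMul K M (f u) (f v) := by
  simp only [logExpMul, ← aeval_algHom_apply, map_sub, map_mul, map_one]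

variable {K X : Type*} [Field K] {N : ℕ}

/-- The Euler operator, which multiplies words by their length. -/
def euler (K X : Type*) [Field K] : WordAlg K X →ₗ[K] WordAlg K X :=
  wordMap fun w => (w.length : K) • word K w

lemma euler_one : euler K X 1 = 0 := by
  rw [← word_nil]
  simp [euler]

lemma euler_letter_mul (a : X) (P : WordAlg K X) :
    euler K X (word K [a] * P) = word K [a] * euler K X P + word K [a] * P := by
  induction P using WordAlg.induction_word with
  | hw w =>
    rw [← word_cons]
    simp only [euler, wordMap_word, List.length_cons, Algebra.mul_smul_comm, ← word_cons]
    push_cast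
    rw [add_smul, one_smul]
  | hadd P Q hP hQ =>
    simp only [mul_add, map_add, hP, hQ]
    abel
  | hsmul c P hP => simp only [Algebra.mul_smul_comm, map_smul, hP, smul_add]

variable (K X N) in
/-- The inverse of the Euler operator on the truncated algebra, extended by zero. -/
def eulerInv : TruncAlg K X N →ₗ[K] TruncAlg K X N :=
  TruncAlg.desc ((TruncAlg.mk K X N).toLinearMap ∘ₗ
    wordMap fun w => (w.length : K)⁻¹ • word K w) (fun w hw => by
      have : TruncAlg.mk K X N (word K w) = 0 := TruncAlg.mk_eq_zero_iff.2 (word_mem_filt hw)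
      simp [this])

variable (K X N) in
/-- The letters of the truncated algebra. -/
def truncLetter (a : X) : TruncAlg K X N := TruncAlg.mk K X N (word K [a])

lemma counit_truncLetter (a : X) : TruncAlg.counit (truncLetter K X N a) = 0 :=
  counit_word (by simp)

lemma nestedBracket_truncLetter (w : List X) :
    nestedBracket (w.map (truncLetter K X N)) =
      TruncAlg.mk K X N (nestedBracket (w.map fun a => word K [a])) := by
  change _ = (TruncAlg.mk K X N).toLieHom _
  rw [LieHom.map_nestedBracket, List.map_map]
  rfl

variable (K X N) in
/-- The Dynkin operator of the truncated algebra. -/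
def truncDynkin : TruncAlg K X N →ₗ[K] TruncAlg K X N :=
  TruncAlg.desc (dynkin (truncLetter K X N)) fun w hw => by
    simp only [dynkin, wordMap_word]
    rw [nestedBracket_truncLetter, TruncAlg.mk_eq_zero_iff]
    have := homog_le_filt _ (nestedBracket_letters_mem_homog (K := K) w)
    exact Submodule.span_mono (Set.image_mono fun v (hv : _ ≤ _) => Nat.le_trans hw hv) this

lemma truncDynkin_mk (P : WordAlg K X) :
    truncDynkin K X N (TruncAlg.mk K X N P) = dynkin (truncLetter K X N) P := rfl

lemma truncDynkin_one : truncDynkin K X N 1 = 0 := by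
  rw [← map_one (TruncAlg.mk K X N), truncDynkin_mk, ← word_nil]
  simp [dynkin, nestedBracket]

/-- A nested bracket of n letters is homogeneous of degree n, so dividing by the degree after
applying D is the same as before. -/
lemma eulerInv_truncDynkin (P : WordAlg K X) :
    eulerInv K X N (dynkin (truncLetter K X N) P) = dynkinNorm (truncLetter K X N) P := by
  induction P using WordAlg.induction_word with
  | hw w =>
    have key : ∀ Q ∈ homog K X w.length, eulerInv K X N (TruncAlg.mk K X N Q) =
        (w.length : K)⁻¹ • TruncAlg.mk K X N Q := by
      intro Q hQ
      induction hQ using Submodule.span_induction with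
      | mem Q h =>
        obtain ⟨v, hv, rfl⟩ := h
        rw [Set.mem_ofPred_eq] at hv
        simp [eulerInv, hv]
      | zero => simp
      | add P Q _ _ hP hQ => simp only [map_add, hP, hQ, smul_add]
      | smul c P _ hP => rw [map_smul, map_smul, hP, smul_comm]
    simp only [dynkin, dynkinNorm, wordMap_word]
    rw [nestedBracket_truncLetter, key _ (nestedBracket_letters_mem_homog w)]
  | hadd P Q hP hQ => simp only [map_add, hP, hQ]
  | hsmul c P hP => simp only [map_smul, hP]

lemma eulerInv_euler [CharZero K] (P : WordAlg K X) (hP : WordAlg.counit P = 0) :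
    eulerInv K X N (TruncAlg.mk K X N (euler K X P)) = TruncAlg.mk K X N P := by
  have key : ∀ P : WordAlg K X, eulerInv K X N (TruncAlg.mk K X N (euler K X P)) =
      TruncAlg.mk K X N P - algebraMap K _ (WordAlg.counit P) := by
    intro P
    induction P using WordAlg.induction_word with
    | hw w =>
      rcases eq_or_ne w [] with rfl | hw
      · simp [word_nil, euler_one]
      · have : (w.length : K) ≠ 0 := by exact_mod_cast (List.length_pos_iff.2 hw).ne'
        rw [counit_word hw, map_zero, sub_zero]
        simp only [euler, eulerInv, wordMap_word, map_smul, TruncAlg.desc_mk, LinearMap.comp_apply,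
          AlgHom.toLinearMap_apply]
        rw [smul_inv_smul₀ this]
    | hadd P Q hP hQ =>
      simp only [map_add, hP, hQ]
      abel
    | hsmul c P hP =>
      rw [map_smul, map_smul, map_smul, map_smul, hP, smul_sub, map_smul, smul_eq_mul, map_mul,
        Algebra.smul_def c (algebraMap K _ _)]
  rw [key, hP, map_zero, sub_zero]

variable (K X N) in
/-- The coproduct for which letters are primitive. -/
def coprod : WordAlg K X →ₐ[K] TruncAlg K X N ⊗[K] TruncAlg K X N :=
  liftAlg fun a => truncLetter K X N a ⊗ₜ 1 + 1 ⊗ₜ truncLetter K X N a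

variable (K X N) in
/-- `u ⊗ v ↦ D(u) v` with the Dynkin operator `D`. -/
def dynkinMul : TruncAlg K X N ⊗[K] TruncAlg K X N →ₗ[K] TruncAlg K X N :=
  LinearMap.mul' K _ ∘ₗ TensorProduct.map (truncDynkin K X N) LinearMap.id

variable (K X N) in
/-- `u ⊗ v ↦ ε(u) v` with the counit `ε`. -/
def counitMul : TruncAlg K X N ⊗[K] TruncAlg K X N →ₗ[K] TruncAlg K X N :=
  LinearMap.mul' K _ ∘ₗ TensorProduct.map
    ((Algebra.linearMap K (TruncAlg K X N)) ∘ₗ TruncAlg.counit.toLinearMap) LinearMap.id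

lemma counitMul_primitive_mul (a : X) (z : TruncAlg K X N ⊗[K] TruncAlg K X N) :
    counitMul K X N ((truncLetter K X N a ⊗ₜ 1 + 1 ⊗ₜ truncLetter K X N a) * z) =
      truncLetter K X N a * counitMul K X N z := by
  induction z with
  | zero => simp
  | add x y hx hy => simp only [mul_add, map_add, hx, hy]
  | tmul u v =>
    simp [counitMul, add_mul, counit_truncLetter, ← Algebra.smul_def]

/-- For z = u ⊗ v, the summand -D(u)av from D(au) = [a, D(u)] + ε(u)a cancels against the
contribution of 1 ⊗ a. -/
lemma dynkinMul_primitive_mul (a : X) (z : TruncAlg K X N ⊗[K] TruncAlg K X N) :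
    dynkinMul K X N ((truncLetter K X N a ⊗ₜ 1 + 1 ⊗ₜ truncLetter K X N a) * z) =
      truncLetter K X N a * dynkinMul K X N z + truncLetter K X N a * counitMul K X N z := by
  induction z with
  | zero => simp
  | add x y hx hy =>
    simp only [mul_add, map_add, hx, hy]
    abel
  | tmul u v =>
    have h1 : truncDynkin K X N (truncLetter K X N a * u) =
        truncLetter K X N a * truncDynkin K X N u - truncDynkin K X N u * truncLetter K X N a +
          TruncAlg.counit u • truncLetter K X N a := by
      obtain ⟨P, rfl⟩ := TruncAlg.mk_surjective u
      rw [truncDynkin_mk, TruncAlg.counit_mk, ← Ring.lie_def, ← dynkin_letter_mul,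
        ← truncDynkin_mk, map_mul (TruncAlg.mk K X N)]
      rfl
    simp only [dynkinMul, counitMul, add_mul, Algebra.TensorProduct.tmul_mul_tmul, one_mul, map_add,
      LinearMap.comp_apply, TensorProduct.map_tmul, LinearMap.mul'_apply, LinearMap.id_apply, h1,
      AlgHom.toLinearMap_apply, Algebra.linearMap_apply, sub_mul, Algebra.smul_mul_assoc,
      ← Algebra.smul_def, Algebra.mul_smul_comm, mul_assoc]
    abel

lemma counitMul_coprod (P : WordAlg K X) :
    counitMul K X N (coprod K X N P) = TruncAlg.mk K X N P := by
  induction P using WordAlg.induction_word with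
  | hw w =>
    induction w with
    | nil => simp [word_nil, counitMul, Algebra.TensorProduct.one_def]
    | cons a w ih =>
      rw [word_cons, map_mul, map_mul (TruncAlg.mk K X N), ← ih]
      have : coprod K X N (word K [a]) =
        truncLetter K X N a ⊗ₜ 1 + 1 ⊗ₜ truncLetter K X N a := by simp [coprod]
      rw [this, counitMul_primitive_mul]
      rfl
  | hadd P Q hP hQ => simp only [map_add, hP, hQ]
  | hsmul c P hP => simp only [map_smul, hP]

/-- The convolution of D with the identity is the Euler operator. On a primitive element the
convolution collapses to D itself, and so primitive elements are eigenvectors of D in each degree.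
-/
lemma dynkinMul_coprod (P : WordAlg K X) :
    dynkinMul K X N (coprod K X N P) = TruncAlg.mk K X N (euler K X P) := by
  induction P using WordAlg.induction_word with
  | hw w =>
    induction w with
    | nil =>
      rw [word_nil, map_one, Algebra.TensorProduct.one_def]
      simp [dynkinMul, truncDynkin_one, euler_one]
    | cons a w ih =>
      rw [word_cons, euler_letter_mul, map_mul, map_add, map_mul (TruncAlg.mk K X N),
        map_mul (TruncAlg.mk K X N), ← ih]
      have : coprod K X N (word K [a]) =
        truncLetter K X N a ⊗ₜ 1 + 1 ⊗ₜ truncLetter K X N a := by simp [coprod]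
      rw [this, dynkinMul_primitive_mul, counitMul_coprod]
      rfl
  | hadd P Q hP hQ => simp only [map_add, hP, hQ]
  | hsmul c P hP => simp only [map_smul, hP]

lemma counit_exp_sub_one {M : ℕ} {u : TruncAlg K X N} (hu : TruncAlg.counit u = 0) :
    TruncAlg.counit (aeval u (expPoly K M) - 1) = 0 := by
  obtain ⟨q, hq⟩ := exists_aeval_expPoly_sub_one_eq (K := K) M u
  rw [hq, map_mul, hu, zero_mul]

lemma counit_exp_mul_exp_sub_one {M : ℕ} {u v : TruncAlg K X N} (hu : TruncAlg.counit u = 0)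
    (hv : TruncAlg.counit v = 0) :
    TruncAlg.counit (aeval u (expPoly K M) * aeval v (expPoly K M) - 1) = 0 := by
  have h1 := counit_exp_sub_one (M := M) hu
  have h2 := counit_exp_sub_one (M := M) hv
  rw [map_sub, map_one, sub_eq_zero] at h1 h2
  rw [map_sub, map_mul, h1, h2, map_one, mul_one, sub_self]

lemma counit_logExpMul {M : ℕ} {u v : TruncAlg K X N} (hu : TruncAlg.counit u = 0)
    (hv : TruncAlg.counit v = 0) : TruncAlg.counit (logExpMul K M u v) = 0 := by
  obtain ⟨q, hq⟩ := exists_aeval_logPoly_eq (K := K) M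
    (aeval u (expPoly K M) * aeval v (expPoly K M) - 1)
  rw [logExpMul, hq, map_mul, counit_exp_mul_exp_sub_one hu hv, zero_mul]

variable [CharZero K]

/-- `log (exp x * exp y)` is primitive. -/
lemma coprod_logExpMul {M : ℕ} (hM : 2 * N ≤ M) (a b : X) :
    coprod K X N (logExpMul K M (word K [a]) (word K [b])) =
      logExpMul K M (truncLetter K X N a) (truncLetter K X N b) ⊗ₜ 1 +
        1 ⊗ₜ logExpMul K M (truncLetter K X N a) (truncLetter K X N b) := by
  set B := TruncAlg K X N
  set il : B →ₐ[K] B ⊗[K] B := Algebra.TensorProduct.includeLeft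
  set ir : B →ₐ[K] B ⊗[K] B := Algebra.TensorProduct.includeRight
  have hcomm : ∀ u v, Commute (il u) (ir v) := fun u v => by
    simp [il, ir, Commute, SemiconjBy]
  have hletter : ∀ c, coprod K X N (word K [c]) =
      il (truncLetter K X N c) + ir (truncLetter K X N c) := fun c => by simp [coprod, il, ir]
  -- A primitive element has a group-like exponential, because u ⊗ 1 and 1 ⊗ u commute. Their sum is
  -- nilpotent only of order 2N + 1, which accounts for 2N ≤ M.
  have hexp : ∀ c, aeval (il (truncLetter K X N c) + ir (truncLetter K X N c)) (expPoly K M) =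
      il (aeval (truncLetter K X N c) (expPoly K M)) *
        ir (aeval (truncLetter K X N c) (expPoly K M)) := by
    intro c
    have h0 := TruncAlg.pow_eq_zero_of_counit (counit_truncLetter (K := K) (N := N) c)
    have h1 : il (truncLetter K X N c) ^ (N + 1) = 0 := by rw [← map_pow, h0, map_zero]
    have h2 : ir (truncLetter K X N c) ^ (N + 1) = 0 := by rw [← map_pow, h0, map_zero]
    rw [← aeval_algHom_apply, ← aeval_algHom_apply]
    refine aeval_expPoly_add (hcomm _ _) (pow_eq_zero_of_le (by omega) h1)
      (pow_eq_zero_of_le (by omega) h2) ?_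
    exact pow_eq_zero_of_le (by omega : 2 * N + 1 ≤ M + 1)
      ((hcomm _ _).add_pow_eq_zero_of_add_le_succ_of_pow_eq_zero h1 h2 (by omega))
  set g := aeval (truncLetter K X N a) (expPoly K M)
  set h := aeval (truncLetter K X N b) (expPoly K M)
  have hw : TruncAlg.counit (g * h - 1) = 0 :=
    counit_exp_mul_exp_sub_one (counit_truncLetter a) (counit_truncLetter b)
  have hw' := TruncAlg.pow_eq_zero_of_counit hw
  rw [AlgHom.map_logExpMul, hletter, hletter, logExpMul, hexp, hexp]
  have h3 : il g * ir g * (il h * ir h) - 1 =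
      (1 + il (g * h - 1)) * (1 + ir (g * h - 1)) - 1 := by
    simp only [map_sub, map_mul, map_one, add_sub_cancel]
    rw [mul_assoc, ← mul_assoc (ir g), (hcomm h g).eq.symm, mul_assoc, mul_assoc]
  rw [h3, log_mul_of_commute hM (hcomm _ _) (by rw [← map_pow, hw', map_zero])
    (by rw [← map_pow, hw', map_zero]), aeval_algHom_apply, aeval_algHom_apply]
  rfl

/-- Friedrichs' theorem for `log (exp x * exp y)`. -/
lemma dynkinNorm_logExpMul {M : ℕ} (hM : 2 * N ≤ M) (a b : X) :
    dynkinNorm (truncLetter K X N) (logExpMul K M (word K [a]) (word K [b])) =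
      logExpMul K M (truncLetter K X N a) (truncLetter K X N b) := by
  set P := logExpMul K M (word K [a]) (word K [b])
  have hP : TruncAlg.mk K X N P = logExpMul K M (truncLetter K X N a) (truncLetter K X N b) :=
    AlgHom.map_logExpMul _ _ _ _
  have h0 : WordAlg.counit P = 0 := by
    rw [← TruncAlg.counit_mk (N := N), hP]
    exact counit_logExpMul (counit_truncLetter a) (counit_truncLetter b)
  have h1 := dynkinMul_coprod (N := N) P
  -- As D(1) = 0, primitivity reduces the convolution identity to D(P) = E(P) with the Euler
  -- operator E; inverting E gives the claim.
  rw [coprod_logExpMul hM, ← hP] at h1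
  simp only [dynkinMul, map_add, LinearMap.comp_apply, TensorProduct.map_tmul, LinearMap.mul'_apply,
    LinearMap.id_apply, truncDynkin_one, zero_mul, add_zero, mul_one, truncDynkin_mk] at h1
  rw [← hP, ← eulerInv_euler P h0, ← h1, eulerInv_truncDynkin]

end Friedrichs

end

noncomputable section

attribute [local instance] LieRing.ofAssociativeRing

open WordAlg Polynomial

/-! ### Expansion of `log (exp x * exp y)` into words -/

section Expansion

variable {K X : Type*} [Field K]

lemma sum_pow_eq_sum_piFinset {A ι : Type*} [Ring A] [Algebra K A] (s : Finset ι) (g : ι → A)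
    (m : ℕ) : (∑ j ∈ s, g j) ^ m =
      ∑ p ∈ Fintype.piFinset (fun _ : Fin m => s), (List.ofFn fun i => g (p i)).prod := by
  classical
  have := (MultilinearMap.mkPiAlgebraFin K m A).map_sum_finset (fun _ j => g j) (fun _ => s)
  simpa [MultilinearMap.mkPiAlgebraFin_apply, List.ofFn_const] using this

lemma prod_ofFn_smul_word {m : ℕ} (c : Fin m → K) (u : Fin m → List X) :
    (List.ofFn fun i => c i • word K (u i)).prod =
      (∏ i, c i) • word K (List.ofFn u).flatten := by
  induction m with
  | zero => simp [word_nil]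
  | succ m ih =>
    rw [List.ofFn_succ, List.prod_cons, ih, List.ofFn_succ, Fin.prod_univ_succ, List.flatten_cons,
      smul_mul_smul_comm, word_mul]

lemma exp_mul_exp_sub_one_eq_sum (M : ℕ) (a b : X) :
    aeval (word K [a]) (expPoly K M) * aeval (word K [b]) (expPoly K M) - 1 =
      ∑ rs ∈ ((Finset.range (M + 1)) ×ˢ (Finset.range (M + 1))).filter
          (fun rs : ℕ × ℕ => 0 < rs.1 + rs.2),
        ((rs.1.factorial * rs.2.factorial : ℕ) : K)⁻¹ •
          word K (List.replicate rs.1 a ++ List.replicate rs.2 b) := by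
  have h1 : ∀ c : X, aeval (word K [c]) (expPoly K M) =
      ∑ r ∈ Finset.range (M + 1), ((r.factorial : ℕ) : K)⁻¹ • word K (List.replicate r c) := by
    intro c
    rw [expPoly, map_sum]
    refine Finset.sum_congr rfl fun i _ => ?_
    rw [map_mul, aeval_C, map_pow, aeval_X, ← Algebra.smul_def, word_single_pow]
  rw [h1, h1, Finset.sum_mul_sum, ← Finset.sum_product',
    ← Finset.sum_filter_add_sum_filter_not _ (fun rs : ℕ × ℕ => 0 < rs.1 + rs.2)]
  have h2 : ((Finset.range (M + 1)) ×ˢ (Finset.range (M + 1))).filter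
      (fun rs : ℕ × ℕ => ¬ 0 < rs.1 + rs.2) = {(0, 0)} := by
    ext ⟨r, s⟩
    simp only [Finset.mem_filter, Finset.mem_product, Finset.mem_range, Finset.mem_singleton,
      Prod.mk.injEq]
    omega
  rw [h2, Finset.sum_singleton]
  simp only [List.replicate_zero, word_nil, Nat.factorial_zero, Nat.cast_one, inv_one, one_smul,
    mul_one, add_sub_cancel_right]
  refine Finset.sum_congr rfl fun rs _ => ?_
  rw [smul_mul_smul_comm, word_mul, Nat.cast_mul, mul_inv]

/-- Dynkin's formula: the truncated Dynkin series is the image of `log (exp x * exp y)` under the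
normalised Dynkin operator. -/
lemma dynkinNorm_logExpMul_eq_bchTrunc {L : Type*} [LieRing L] [LieAlgebra K L] (φ : X → L)
    (M : ℕ) (a b : X) :
    dynkinNorm φ (logExpMul K M (word K [a]) (word K [b])) = bchTrunc K M (φ a) (φ b) := by
  rw [logExpMul, exp_mul_exp_sub_one_eq_sum, logPoly, map_sum, map_sum, bchTrunc]
  refine Finset.sum_congr rfl fun m _ => ?_
  rw [map_mul, aeval_C, map_pow, aeval_X, ← Algebra.smul_def, sum_pow_eq_sum_piFinset (K := K),
    map_smul, map_sum, Finset.smul_sum]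
  refine Finset.sum_congr rfl fun p _ => ?_
  rw [prod_ofFn_smul_word, map_smul, dynkinNorm, wordMap_word, smul_smul, smul_smul]
  congr 1
  · have : (List.ofFn fun i => List.replicate (p i).1 a ++ List.replicate (p i).2 b).flatten.length
        = ∑ i, ((p i).1 + (p i).2) := by
      simp [List.length_flatten, List.map_ofFn, Function.comp_def, List.sum_ofFn]
    rw [this]
    ring
  · simp [List.map_flatten, List.map_ofFn, Function.comp_def]

end Expansion

/-! ### Associativity of the Baker–Campbell–Hausdorff product -/

section TruncAssoc

variable {K X : Type*} [Field K] {N : ℕ}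

lemma logExpMul_eq_of_le {M : ℕ} (hM : N ≤ M) {u v : TruncAlg K X N}
    (hu : TruncAlg.counit u = 0) (hv : TruncAlg.counit v = 0) :
    logExpMul K M u v = logExpMul K N u v := by
  rw [logExpMul, logExpMul, aeval_expPoly_eq_of_le hM (TruncAlg.pow_eq_zero_of_counit hu),
    aeval_expPoly_eq_of_le hM (TruncAlg.pow_eq_zero_of_counit hv),
    aeval_logPoly_eq_of_le hM
      (TruncAlg.pow_eq_zero_of_counit (counit_exp_mul_exp_sub_one hu hv))]

variable {L : Type*} [LieRing L] [LieAlgebra K L]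

/-- The normalised Dynkin operator descends to the truncated algebra when long brackets vanish. -/
def descDynkin (hL : ∀ l : List L, N < l.length → nestedBracket l = 0) (φ : X → L) :
    TruncAlg K X N →ₗ[K] L :=
  TruncAlg.desc (dynkinNorm φ) fun w hw => by
    simp [dynkinNorm, hL (w.map φ) (by simpa using hw)]

/-- No index sets are compared: both sums are images of a logarithm in the algebra truncated at N,
where a larger order changes nothing. -/
lemma bchTrunc_eq_of_le (hL : ∀ l : List L, N < l.length → nestedBracket l = 0) {M : ℕ}
    (hM : N ≤ M) (x y : L) : bchTrunc K M x y = bchTrunc K N x y := by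
  have h : ∀ M', bchTrunc K M' x y = descDynkin hL (fun b => cond b x y)
      (logExpMul K M' (truncLetter K Bool N true) (truncLetter K Bool N false)) := fun M' => by
    rw [truncLetter, truncLetter, ← AlgHom.map_logExpMul, descDynkin, TruncAlg.desc_mk,
      dynkinNorm_logExpMul_eq_bchTrunc]
    rfl
  rw [h, h, logExpMul_eq_of_le hM (counit_truncLetter _) (counit_truncLetter _)]

variable [CharZero K]

lemma exp_logExpMul {M : ℕ} (hM : N ≤ M) {u v : TruncAlg K X N} (hu : TruncAlg.counit u = 0)
    (hv : TruncAlg.counit v = 0) :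
    aeval (logExpMul K M u v) (expPoly K M) =
      aeval u (expPoly K M) * aeval v (expPoly K M) := by
  have h := TruncAlg.pow_eq_zero_of_counit (counit_exp_mul_exp_sub_one (M := M) hu hv)
  rw [logExpMul, exp_log (pow_eq_zero_of_le (by omega) h), add_sub_cancel]

lemma exp_injective {M : ℕ} (hM : N ≤ M) {u v : TruncAlg K X N} (hu : TruncAlg.counit u = 0)
    (hv : TruncAlg.counit v = 0) (h : aeval u (expPoly K M) = aeval v (expPoly K M)) : u = v := by
  rw [← log_exp (K := K) (pow_eq_zero_of_le (Nat.succ_le_succ hM) (TruncAlg.pow_eq_zero_of_counit hu)), h,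
    log_exp (pow_eq_zero_of_le (Nat.succ_le_succ hM) (TruncAlg.pow_eq_zero_of_counit hv))]

/-- The Baker–Campbell–Hausdorff formula in the truncated algebra. -/
lemma bchTrunc_eq_logExpMul {M : ℕ} (hM : 2 * N ≤ M) {u v : TruncAlg K X N}
    (hu : TruncAlg.counit u = 0) (hv : TruncAlg.counit v = 0) :
    bchTrunc K M u v = logExpMul K M u v := by
  -- Substitution of u and v for the two letters; it respects the truncation because u and v have no
  -- constant term.
  let f : TruncAlg K Bool N →ₐ[K] TruncAlg K X N :=
    TruncAlg.descAlg (liftAlg fun b => cond b u v) fun w hw => by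
      rw [liftAlg_word]
      refine TruncAlg.prod_eq_zero (fun c hc => ?_) (by simpa using hw)
      obtain ⟨b, -, rfl⟩ := List.mem_map.1 hc
      cases b
      exacts [hv, hu]
  have hf1 : f (truncLetter K Bool N true) = u := by simp [f, truncLetter]
  have hf2 : f (truncLetter K Bool N false) = v := by simp [f, truncLetter]
  have h := (dynkinNorm_logExpMul_eq_bchTrunc (truncLetter K Bool N) M true false).symm.trans
    (dynkinNorm_logExpMul hM true false)
  have h2 := congrArg f h
  have h3 : f (bchTrunc K M (truncLetter K Bool N true) (truncLetter K Bool N false)) =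
      bchTrunc K M (f (truncLetter K Bool N true)) (f (truncLetter K Bool N false)) :=
    LieHom.map_bchTrunc f.toLieHom M _ _
  rwa [AlgHom.map_logExpMul, h3, hf1, hf2] at h2

lemma counit_bchTrunc {M : ℕ} (hM : 2 * N ≤ M) {u v : TruncAlg K X N}
    (hu : TruncAlg.counit u = 0) (hv : TruncAlg.counit v = 0) :
    TruncAlg.counit (bchTrunc K M u v) = 0 := by
  rw [bchTrunc_eq_logExpMul hM hu hv]
  exact counit_logExpMul hu hv

lemma bchTrunc_assoc_truncAlg {M : ℕ} (hM : 2 * N ≤ M) {u v w : TruncAlg K X N}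
    (hu : TruncAlg.counit u = 0) (hv : TruncAlg.counit v = 0) (hw : TruncAlg.counit w = 0) :
    bchTrunc K M (bchTrunc K M u v) w = bchTrunc K M u (bchTrunc K M v w) := by
  have huv := counit_bchTrunc hM hu hv
  have hvw := counit_bchTrunc hM hv hw
  have hNM : N ≤ M := by omega
  refine exp_injective hNM (counit_bchTrunc hM huv hw) (counit_bchTrunc hM hu hvw) ?_
  rw [bchTrunc_eq_logExpMul hM huv hw, bchTrunc_eq_logExpMul hM hu hvw, exp_logExpMul hNM huv hw,
    exp_logExpMul hNM hu hvw, bchTrunc_eq_logExpMul hM hu hv, bchTrunc_eq_logExpMul hM hv hw,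
    exp_logExpMul hNM hu hv, exp_logExpMul hNM hv hw, mul_assoc]

/-- Associativity holds for the images of the generators of the free Lie algebra in the truncated
associative algebra. The normalised Dynkin operator recovers from the image of a Lie element its
value at x, y, z, so applying it to the identity suffices. -/
lemma bchTrunc_assoc (hL : ∀ l : List L, N < l.length → nestedBracket l = 0) {M : ℕ}
    (hM : 2 * N ≤ M) (x y z : L) :
    bchTrunc K M (bchTrunc K M x y) z = bchTrunc K M x (bchTrunc K M y z) := by
  let φ : Fin 3 → L := ![x, y, z]
  let f : FreeLieAlgebra K (Fin 3) →ₗ⁅K⁆ TruncAlg K (Fin 3) N :=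
    (TruncAlg.mk K (Fin 3) N).toLieHom.comp (freeLieToWord K (Fin 3))
  have key : ∀ W, FreeLieAlgebra.lift K φ W = descDynkin hL φ (f W) := fun W =>
    (dynkinNorm_freeLieToWord φ W).symm
  have hf : ∀ i, TruncAlg.counit (f (FreeLieAlgebra.of K i)) = 0 := fun i => by
    have : f (FreeLieAlgebra.of K i) = truncLetter K (Fin 3) N i := by
      simp [f, freeLieToWord, truncLetter]
    rw [this]
    exact counit_truncLetter i
  have h := bchTrunc_assoc_truncAlg hM (hf 0) (hf 1) (hf 2)
  simp only [← LieHom.map_bchTrunc] at h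
  have h2 := congrArg (descDynkin hL φ) h
  rw [← key, ← key] at h2
  simp only [LieHom.map_bchTrunc, FreeLieAlgebra.lift_of_apply] at h2
  exact h2

end TruncAssoc

/-! ### Dynkin's product on a nilpotent Lie algebra -/

section Nilpotent

variable {K L : Type*} [Field K] [LieRing L] [LieAlgebra K L]

/-- A bracket of n entries uses n - 1 commutators, and the series is indexed from 0; for the empty
list the subtraction gives 0. -/
lemma nestedBracket_mem_lowerCentralSeries (l : List L) :
    nestedBracket l ∈ LieModule.lowerCentralSeries ℤ L L (l.length - 1) := by
  induction l with
  | nil => exact zero_mem _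
  | cons a l ih =>
    rcases eq_or_ne l [] with rfl | hl
    · simp
    · obtain ⟨k, hk⟩ : ∃ k, l.length = k + 1 :=
        Nat.exists_eq_succ_of_ne_zero (List.length_pos_iff.2 hl).ne'
      rw [nestedBracket_cons a hl, List.length_cons, hk, Nat.add_sub_cancel,
        LieModule.lowerCentralSeries_succ]
      rw [hk, Nat.add_sub_cancel] at ih
      exact LieSubmodule.lie_mem_lie (LieSubmodule.mem_top a) ih

variable [LieRing.IsNilpotent L]

lemma nestedBracket_eq_zero {l : List L} (hl : LieModule.nilpotencyLength L L < l.length) :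
    nestedBracket l = 0 := by
  have h1 : LieModule.lowerCentralSeries ℤ L L (LieModule.nilpotencyLength L L) = ⊥ :=
    Nat.sInf_mem (LieModule.IsNilpotent.nilpotent ℤ L L)
  have h2 := LieModule.antitone_lowerCentralSeries ℤ L L
    (by omega : LieModule.nilpotencyLength L L ≤ l.length - 1)
  rw [h1, le_bot_iff] at h2
  have h3 := nestedBracket_mem_lowerCentralSeries l
  rwa [h2, LieSubmodule.mem_bot] at h3

/-- Frees the product from the nilpotency length, so that algebras of different length can be
compared at a common order. -/
lemma bch_eq_bchTrunc_of_le {M : ℕ} (hM : LieModule.nilpotencyLength L L ≤ M) (x y : L) :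
    bch K x y = bchTrunc K M x y := by
  rw [bchTrunc_eq_of_le (fun l hl => nestedBracket_eq_zero hl) hM, bch_eq_bchTrunc]

lemma LieHom.map_bch {L' : Type*} [LieRing L'] [LieAlgebra K L'] [LieRing.IsNilpotent L']
    (f : L →ₗ⁅K⁆ L') (x y : L) : f (bch K x y) = bch K (f x) (f y) := by
  rw [bch_eq_bchTrunc_of_le (le_max_left _ (LieModule.nilpotencyLength L' L')),
    bch_eq_bchTrunc_of_le (le_max_right (LieModule.nilpotencyLength L L) _), LieHom.map_bchTrunc]

variable [CharZero K]

variable (K) in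
lemma bch_assoc (x y z : L) : bch K (bch K x y) z = bch K x (bch K y z) := by
  have hM : LieModule.nilpotencyLength L L ≤ 2 * LieModule.nilpotencyLength L L := by omega
  simp only [bch_eq_bchTrunc_of_le hM]
  exact bchTrunc_assoc (fun l hl => nestedBracket_eq_zero hl) le_rfl x y z

end Nilpotent

end

noncomputable section

attribute [local instance] LieRing.ofAssociativeRing

/-! ### The group structure in exponential coordinates -/

section Normalizer

variable {K L : Type*} [Field K] [LieRing L] [LieAlgebra K L]

/-- The quotient of K X + H by its ideal H is spanned by one element, hence abelian. -/
lemma lie_mem_of_mem_normalizer {H : LieSubalgebra K L} {X : L} (hX : X ∈ H.normalizer) {y z : L}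
    (hy : y ∈ (K ∙ X) ⊔ H.toSubmodule) (hz : z ∈ (K ∙ X) ⊔ H.toSubmodule) : ⁅y, z⁆ ∈ H := by
  obtain ⟨u₁, hu₁, v, hv, rfl⟩ := Submodule.mem_sup.1 hy
  obtain ⟨u₂, hu₂, w, hw, rfl⟩ := Submodule.mem_sup.1 hz
  obtain ⟨t, rfl⟩ := Submodule.mem_span_singleton.1 hu₁
  obtain ⟨s, rfl⟩ := Submodule.mem_span_singleton.1 hu₂
  simp only [smul_lie, add_lie, zero_add, lie_add, smul_zero, lie_smul, lie_self]
  exact H.add_mem (H.smul_mem s ((H.mem_normalizer_iff' X).1 hX v hv))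
    (H.add_mem (H.smul_mem t ((H.mem_normalizer_iff X).1 hX w hw)) (H.lie_mem hv hw))

end Normalizer

/-! ### The product modulo a subalgebra -/

section BchMod

open WordAlg Polynomial

variable {K L : Type*} [Field K] [CharZero K] [LieRing L] [LieAlgebra K L]
  [LieRing.IsNilpotent L]

/-- The Baker–Campbell–Hausdorff product is the sum up to nested brackets with at least two
entries. -/
lemma bch_sub_add_mem (I : Submodule K L) {x y : L}
    (h : ∀ l : List L, (∀ a ∈ l, a = x ∨ a = y) → 2 ≤ l.length → nestedBracket l ∈ I) :
    bch K x y - (x + y) ∈ I := by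
  let φ : Bool → L := fun b => cond b x y
  -- Modulo I all brackets of length at least two vanish, so truncation at N = 1 is enough, where
  -- log(exp a · exp b) is just a + b.
  let Ψ : TruncAlg K Bool 1 →ₗ[K] L ⧸ I := TruncAlg.desc (I.mkQ ∘ₗ dynkinNorm φ) fun w hw => by
    have : nestedBracket (w.map φ) ∈ I := by
      refine h _ (fun a ha => ?_) (by rw [List.length_map]; exact hw)
      obtain ⟨b, -, rfl⟩ := List.mem_map.1 ha
      cases b <;> simp [φ]
    simp [dynkinNorm, (Submodule.Quotient.mk_eq_zero I).2 this]
  set M := max (LieModule.nilpotencyLength L L) 1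
  have h1 : I.mkQ (bch K x y) =
      Ψ (logExpMul K M (truncLetter K Bool 1 true) (truncLetter K Bool 1 false)) := by
    rw [truncLetter, truncLetter, ← AlgHom.map_logExpMul, TruncAlg.desc_mk, LinearMap.comp_apply,
      dynkinNorm_logExpMul_eq_bchTrunc,
      bch_eq_bchTrunc_of_le (le_max_left _ _ : LieModule.nilpotencyLength L L ≤ M)]
    rfl
  have h2 : logExpMul K 1 (truncLetter K Bool 1 true) (truncLetter K Bool 1 false) =
      truncLetter K Bool 1 true + truncLetter K Bool 1 false := by
    have h3 : truncLetter K Bool 1 true * truncLetter K Bool 1 false = 0 := by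
      rw [truncLetter, truncLetter, ← map_mul, TruncAlg.mk_eq_zero_iff, word_mul]
      exact word_mem_filt (by simp)
    simp [logExpMul, expPoly, logPoly, Finset.sum_range_succ, mul_add, add_mul, h3]
    abel
  have h4 : ∀ b, Ψ (truncLetter K Bool 1 b) = I.mkQ (φ b) := fun b => by
    rw [truncLetter, TruncAlg.desc_mk]
    simp [dynkinNorm, nestedBracket]
  rw [logExpMul_eq_of_le (le_max_right _ _) (counit_truncLetter _) (counit_truncLetter _), h2,
    map_add, h4, h4, ← map_add] at h1
  exact (Submodule.Quotient.eq I).1 h1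

/-- Modulo a subalgebra `H` normalised by `X`, the product of elements of `K X + H` is the sum. -/
lemma bch_sub_add_mem_of_mem_normalizer {H : LieSubalgebra K L} {X : L} (hX : X ∈ H.normalizer)
    {x y : L} (hx : x ∈ (K ∙ X) ⊔ H.toSubmodule) (hy : y ∈ (K ∙ X) ⊔ H.toSubmodule) :
    bch K x y - (x + y) ∈ H := by
  have key : ∀ l : List L, (∀ a ∈ l, a = x ∨ a = y) →
      nestedBracket l ∈ (K ∙ X) ⊔ H.toSubmodule ∧ (2 ≤ l.length → nestedBracket l ∈ H) := by
    intro l hl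
    induction l with
    | nil => exact ⟨zero_mem _, by simp⟩
    | cons a l ih =>
      have ha : a ∈ (K ∙ X) ⊔ H.toSubmodule := by
        rcases hl a List.mem_cons_self with rfl | rfl <;> assumption
      rcases eq_or_ne l [] with rfl | hne
      · exact ⟨ha, by simp⟩
      · rw [nestedBracket_cons a hne]
        have h1 := lie_mem_of_mem_normalizer hX ha
          (ih fun b hb => hl b (List.mem_cons_of_mem _ hb)).1
        exact ⟨Submodule.mem_sup_right h1, fun _ => h1⟩
  exact bch_sub_add_mem H.toSubmodule fun l hl h2 => (key l hl).2 h2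

lemma bch_mem (H : LieSubalgebra K L) {x y : L} (hx : x ∈ H) (hy : y ∈ H) : bch K x y ∈ H := by
  have := H.add_mem (bch_sub_add_mem_of_mem_normalizer (H := H) (X := x) (H.le_normalizer hx)
    (Submodule.mem_sup_right hx) (Submodule.mem_sup_right hy)) (H.add_mem hx hy)
  rwa [sub_add_cancel] at this

lemma bch_smul_smul (X : L) (s t : K) : bch K (s • X) (t • X) = (s + t) • X := by
  -- With H = 0 the product on the line K X is exactly the sum.
  have hX : X ∈ (⊥ : LieSubalgebra K L).normalizer := by
    rw [LieSubalgebra.mem_normalizer_iff]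
    intro y hy
    rw [LieSubalgebra.mem_bot] at hy
    simp [hy]
  have h : ∀ c : K, c • X ∈ (K ∙ X) ⊔ (⊥ : LieSubalgebra K L).toSubmodule := fun c =>
    Submodule.mem_sup_left (Submodule.smul_mem _ _ (Submodule.mem_span_singleton_self X))
  have := bch_sub_add_mem_of_mem_normalizer hX (h s) (h t)
  rw [LieSubalgebra.mem_bot, sub_eq_zero] at this
  rw [this, add_smul]

lemma bch_zero_left (x : L) : bch K 0 x = x := by
  simpa using bch_smul_smul (K := K) x 0 1

lemma bch_neg_self (x : L) : bch K (-x) x = 0 := by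
  simpa using bch_smul_smul (K := K) x (-1) 1

end BchMod

namespace ExpGroup

section Inv

variable {K L : Type*} [AddGroup L]

instance : One (ExpGroup K L) := ⟨exp 0⟩

instance : Inv (ExpGroup K L) := ⟨fun p => exp (-p.log)⟩

lemma log_inv (p : ExpGroup K L) : p⁻¹.log = -p.log := rfl

end Inv

variable {K L : Type*} [Field K] [LieRing L] [LieAlgebra K L]

lemma exp_mul_exp (x y : L) : (exp x * exp y : ExpGroup K L) = exp (bch K x y) := rfl

lemma log_mul (p q : ExpGroup K L) : (p * q).log = bch K p.log q.log := rfl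

variable [CharZero K] [LieRing.IsNilpotent L]

instance : Group (ExpGroup K L) :=
  Group.ofLeftAxioms (fun p q r => ExpGroup.ext (bch_assoc K p.log q.log r.log))
    (fun p => ExpGroup.ext (bch_zero_left p.log)) (fun p => ExpGroup.ext (bch_neg_self p.log))

/-- The subgroup of a Lie subalgebra. -/
def ofSubalgebra (H : LieSubalgebra K L) : Subgroup (ExpGroup K L) where
  carrier := {p | p.log ∈ H}
  mul_mem' := fun hp hq => bch_mem H hp hq
  one_mem' := H.zero_mem
  inv_mem' := fun hp => H.neg_mem hp

end ExpGroup

/-! ### Polynomial maps -/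

section PolyMap

variable {K V W W' : Type*} [Field K] [AddCommGroup V] [Module K V] [AddCommGroup W] [Module K W]
  [AddCommGroup W'] [Module K W']

variable (K V) in
/-- The algebra of polynomial functions on a vector space. -/
def polyFun : Subalgebra K (V → K) :=
  Algebra.adjoin K (Set.range fun f : Module.Dual K V => (f : V → K))

variable (K) in
/-- A map of vector spaces is polynomial if all its components are. -/
def IsPolyMap (f : V → W) : Prop := ∀ φ : Module.Dual K W, (fun v => φ (f v)) ∈ polyFun K V

lemma LinearMap.isPolyMap (f : V →ₗ[K] W) : IsPolyMap K f := fun φ =>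
  Algebra.subset_adjoin ⟨φ ∘ₗ f, rfl⟩

lemma isPolyMap_const (w : W) : IsPolyMap K (fun _ : V => w) := fun φ =>
  (polyFun K V).algebraMap_mem (φ w)

lemma IsPolyMap.add {f g : V → W} (hf : IsPolyMap K f) (hg : IsPolyMap K g) :
    IsPolyMap K (fun v => f v + g v) := fun φ => by
  simp only [map_add]
  exact (polyFun K V).add_mem (hf φ) (hg φ)

lemma IsPolyMap.sum {ι : Type*} {s : Finset ι} {f : ι → V → W}
    (hf : ∀ i ∈ s, IsPolyMap K (f i)) : IsPolyMap K (fun v => ∑ i ∈ s, f i v) := fun φ => by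
  have := (polyFun K V).sum_mem fun i hi => hf i hi φ
  convert this using 1
  ext v
  simp

lemma IsPolyMap.linear_comp (g : W →ₗ[K] W') {f : V → W} (hf : IsPolyMap K f) :
    IsPolyMap K (fun v => g (f v)) := fun φ => hf (φ ∘ₗ g)

lemma IsPolyMap.const_smul (c : K) {f : V → W} (hf : IsPolyMap K f) :
    IsPolyMap K (fun v => c • f v) := hf.linear_comp (c • LinearMap.id)

lemma IsPolyMap.neg {f : V → W} (hf : IsPolyMap K f) : IsPolyMap K (fun v => -f v) :=
  hf.linear_comp (-LinearMap.id)

/-- Precomposition with f is an algebra homomorphism, so only linear forms on the middle space need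
checking. -/
lemma IsPolyMap.comp {g : W → W'} {f : V → W} (hg : IsPolyMap K g) (hf : IsPolyMap K f) :
    IsPolyMap K (fun v => g (f v)) := fun φ => by
  have h : polyFun K W ≤ (polyFun K V).comap
      (AlgHom.pi fun v => Pi.evalAlgHom K (fun _ : W => K) (f v)) := by
    refine Algebra.adjoin_le ?_
    rintro _ ⟨ψ, rfl⟩
    exact hf ψ
  exact h (hg φ)

lemma IsPolyMap.smul {c : V → K} {f : V → W} (hc : IsPolyMap K c) (hf : IsPolyMap K f) :
    IsPolyMap K (fun v => c v • f v) := fun φ => by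
  simp only [map_smul, smul_eq_mul]
  exact (polyFun K V).mul_mem (hc LinearMap.id) (hf φ)

lemma IsPolyMap.bilinear [FiniteDimensional K W] (B : W →ₗ[K] W →ₗ[K] W') {f g : V → W}
    (hf : IsPolyMap K f) (hg : IsPolyMap K g) : IsPolyMap K (fun v => B (f v) (g v)) := by
  let b := Module.finBasis K W
  have h : ∀ v, B (f v) (g v) = ∑ i, b.coord i (f v) • B (b i) (g v) := fun v => by
    conv_lhs => rw [← b.sum_repr (f v), map_sum, LinearMap.sum_apply]
    simp only [map_smul, LinearMap.smul_apply, Module.Basis.coord_apply]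
  simp only [h]
  exact IsPolyMap.sum fun i _ => (hf.linear_comp (b.coord i)).smul (hg.linear_comp (B (b i)))

variable {L : Type*} [LieRing L] [LieAlgebra K L] [FiniteDimensional K L]

lemma isPolyMap_nestedBracket (l : List (V → L)) (hl : ∀ f ∈ l, IsPolyMap K f) :
    IsPolyMap K (fun v => nestedBracket (l.map fun f => f v)) := by
  induction l with
  | nil => exact isPolyMap_const 0
  | cons f l ih =>
    rcases eq_or_ne l [] with rfl | hne
    · exact hl f List.mem_cons_self
    · have h : ∀ v, nestedBracket ((f :: l).map fun f => f v) =
          ⁅f v, nestedBracket (l.map fun f => f v)⁆ := fun v =>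
        nestedBracket_cons _ (by simpa using hne)
      simp only [h]
      exact (hl f List.mem_cons_self).bilinear (LieModule.toEnd K L L : L →ₗ[K] L →ₗ[K] L)
        (ih fun g hg => hl g (List.mem_cons_of_mem _ hg))

lemma IsPolyMap.bch {f g : V → L} (hf : IsPolyMap K f) (hg : IsPolyMap K g) :
    IsPolyMap K (fun v => bch K (f v) (g v)) := by
  unfold _root_.bch
  refine IsPolyMap.sum fun m _ => IsPolyMap.sum fun p _ => IsPolyMap.const_smul _ ?_
  have := isPolyMap_nestedBracket (K := K)
    (List.ofFn fun i => List.replicate (p i).1 f ++ List.replicate (p i).2 g).flatten (by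
      intro h hh
      simp only [List.mem_flatten, List.mem_ofFn] at hh
      obtain ⟨_, ⟨i, rfl⟩, hi⟩ := hh
      rcases List.mem_append.1 hi with hi | hi
      · rwa [List.eq_of_mem_replicate hi]
      · rwa [List.eq_of_mem_replicate hi])
  simpa only [List.map_flatten, List.map_ofFn, Function.comp_def, List.map_append,
    List.map_replicate] using this

lemma exists_mvPolynomial_of_mem_polyFun {ι : Type*} [Fintype ι] {f : (ι → K) → K}
    (hf : f ∈ polyFun K (ι → K)) : ∃ P : MvPolynomial ι K, ∀ v, f v = P.eval v := by
  classical
  induction hf using Algebra.adjoin_induction with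
  | mem f h =>
    obtain ⟨φ, rfl⟩ := h
    refine ⟨∑ i, MvPolynomial.C (φ (Pi.single i 1)) * MvPolynomial.X i, fun v => ?_⟩
    simp only [map_sum, map_mul, MvPolynomial.eval_C, MvPolynomial.eval_X]
    exact (LinearMap.pi_apply_eq_sum_univ φ v).trans
      (Finset.sum_congr rfl fun i _ => by
        rw [smul_eq_mul, mul_comm]
        congr 2
        ext j
        simp [Pi.single_apply, eq_comm])
  | algebraMap c => exact ⟨MvPolynomial.C c, fun v => by simp⟩
  | add f g _ _ hf hg =>
    obtain ⟨P, hP⟩ := hf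
    obtain ⟨Q, hQ⟩ := hg
    exact ⟨P + Q, fun v => by simp [hP, hQ]⟩
  | mul f g _ _ hf hg =>
    obtain ⟨P, hP⟩ := hf
    obtain ⟨Q, hQ⟩ := hg
    exact ⟨P * Q, fun v => by simp [hP, hQ]⟩

lemma IsPolyMap.contDiff {𝕜 E F : Type*} [RCLike 𝕜] [NormedAddCommGroup E] [NormedSpace 𝕜 E]
    [NormedAddCommGroup F] [NormedSpace 𝕜 F] [FiniteDimensional 𝕜 E] [FiniteDimensional 𝕜 F]
    {f : E → F} (hf : IsPolyMap 𝕜 f) : ContDiff 𝕜 ∞ f := by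
  have h : ∀ g ∈ polyFun 𝕜 E, ContDiff 𝕜 ∞ g := by
    intro g hg
    induction hg using Algebra.adjoin_induction with
    | mem g h =>
      obtain ⟨φ, rfl⟩ := h
      exact (LinearMap.toContinuousLinearMap φ).contDiff
    | algebraMap c => exact contDiff_const
    | add f g _ _ hf hg => exact hf.add hg
    | mul f g _ _ hf hg => exact hf.mul hg
  let b := Module.finBasis 𝕜 F
  have h2 : f = fun v => ∑ i, b.coord i (f v) • b i := by
    funext v
    exact (b.sum_repr (f v)).symm
  rw [h2]
  exact ContDiff.sum fun i _ => (h _ (hf (b.coord i))).smul contDiff_const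

end PolyMap

/-! ### Factorisation of nilpotent groups -/

section Factorization

variable {K L : Type*} [Field K] [LieRing L] [LieAlgebra K L] [LieRing.IsNilpotent L]

/-- Take the last term of the lower central series not contained in H: its bracket with L lies in H,
so each of its elements normalises H. -/
lemma exists_mem_normalizer_notMem {H : LieSubalgebra K L} (hH : H ≠ ⊤) :
    ∃ X ∈ H.normalizer, X ∉ H := by
  classical
  have hex : ∃ k, ∀ x ∈ LieModule.lowerCentralSeries K L L k, x ∈ H := by
    obtain ⟨k, hk⟩ := LieModule.IsNilpotent.nilpotent K L L
    refine ⟨k, fun x hx => ?_⟩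
    rw [hk, LieSubmodule.mem_bot] at hx
    rw [hx]
    exact H.zero_mem
  have hspec := Nat.find_spec hex
  rcases hk : Nat.find hex with _ | k
  · rw [hk] at hspec
    refine absurd (eq_top_iff.2 fun x _ => hspec x ?_) hH
    simp
  · have hmin := Nat.find_min hex (m := k) (by omega)
    push Not at hmin
    obtain ⟨X, hX, hXH⟩ := hmin
    refine ⟨X, (H.mem_normalizer_iff' X).2 fun y _ => hspec _ ?_, hXH⟩
    rw [hk, LieModule.lowerCentralSeries_succ]
    exact LieSubmodule.lie_mem_lie (LieSubmodule.mem_top y) hX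

variable [CharZero K] [FiniteDimensional K L]

open ExpGroup in
/-- If the nilpotent Lie algebra `L` is the sum of subalgebras `a` and `b`, then each element `p` of
its group is a product of elements of the groups of `a` and `b`, the first of which can be chosen
as a polynomial in `p`. -/
lemma exists_isPolyMap_factor (a b : LieSubalgebra K L) (hab : a.toSubmodule ⊔ b.toSubmodule = ⊤) :
    ∃ α : L → L, IsPolyMap K α ∧ ∀ p, α p ∈ a ∧ bch K (-α p) p ∈ b := by
  -- The factorisation is extended from b upwards: a maximal subalgebra on which it is available
  -- must be all of L.
  let S : Set (LieSubalgebra K L) := {H | b ≤ H ∧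
    ∃ α : L → L, IsPolyMap K α ∧ ∀ p ∈ H, α p ∈ a ∧ bch K (-α p) p ∈ b}
  have hbS : b ∈ S := ⟨le_rfl, fun _ => 0, isPolyMap_const 0, fun p hp =>
    ⟨a.zero_mem, by rwa [neg_zero, bch_zero_left]⟩⟩
  obtain ⟨H, ⟨hbH, α, hα, hαH⟩, hmax⟩ :=
    (wellFounded_gt (α := LieSubalgebra K L)).has_min S ⟨b, hbS⟩
  by_cases hH : H = ⊤
  · exact ⟨α, hα, fun p => hαH p (hH ▸ LieSubalgebra.mem_top p)⟩
  exfalso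
  obtain ⟨Y, hYN, hYH⟩ := exists_mem_normalizer_notMem hH
  -- The b-component of the normalising element lies in H; removing it leaves a normalising element
  -- X of a outside H.
  obtain ⟨X, hXa, c, hcb, rfl⟩ := Submodule.mem_sup.1 (hab ▸ Submodule.mem_top : Y ∈ _)
  have hcH : c ∈ H := hbH hcb
  have hXH : X ∉ H := fun h => hYH (H.add_mem h hcH)
  have hXN : X ∈ H.normalizer := by
    have := H.normalizer.sub_mem hYN (H.le_normalizer hcH)
    rwa [add_sub_cancel_right] at this
  let H' : LieSubalgebra K L :=
    { (K ∙ X) ⊔ H.toSubmodule with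
      lie_mem' := fun hx hy => Submodule.mem_sup_right (lie_mem_of_mem_normalizer hXN hx hy) }
  have hHH' : H ≤ H' := fun x hx => Submodule.mem_sup_right (S := K ∙ X) hx
  have hXH' : X ∈ H' :=
    Submodule.mem_sup_left (T := H.toSubmodule) (Submodule.mem_span_singleton_self X)
  obtain ⟨ψ, hψX, hψH⟩ := Submodule.exists_dual_map_eq_bot_of_notMem
    (p := H.toSubmodule) hXH inferInstance
  have hψH' : ∀ h ∈ H, ψ h = 0 := fun h hh => by
    have : ψ h ∈ H.toSubmodule.map ψ := ⟨h, hh, rfl⟩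
    rwa [hψH, Submodule.mem_bot] at this
  let lam : Module.Dual K L := (ψ X)⁻¹ • ψ
  have hlX : lam X = 1 := by simp [lam, inv_mul_cancel₀ hψX]
  have hlH : ∀ h ∈ H, lam h = 0 := fun h hh => by simp [lam, hψH' h hh]
  -- Split off exp(tX) on the left, with t the X-coordinate, and factor the remainder, which lies in
  -- H. As `lam` is linear on all of L, the new map is polynomial everywhere.
  let α' : L → L := fun p => bch K (lam p • X) (α (bch K (-(lam p • X)) p))
  have hsX : IsPolyMap K (fun p => lam p • X) := lam.isPolyMap.smul (isPolyMap_const X)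
  have hα' : IsPolyMap K α' :=
    hsX.bch (hα.comp (hsX.neg.bch (LinearMap.id : L →ₗ[K] L).isPolyMap))
  refine hmax H' ⟨hbH.trans hHH', α', hα', fun p hp => ?_⟩ (lt_of_le_of_ne hHH' ?_)
  · obtain ⟨u, hu, h, hh, rfl⟩ := Submodule.mem_sup.1 hp
    obtain ⟨t, rfl⟩ := Submodule.mem_span_singleton.1 hu
    have ht : lam (t • X + h) = t := by simp [hlX, hlH h hh]
    have hX' : ∀ s : K, s • X ∈ (K ∙ X) ⊔ H.toSubmodule := fun s =>
      Submodule.mem_sup_left (Submodule.smul_mem _ _ (Submodule.mem_span_singleton_self X))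
    set p₁ := bch K (-(t • X)) (t • X + h) with hp₁
    have hp₁H : p₁ ∈ H := by
      have h1 := bch_sub_add_mem_of_mem_normalizer hXN (x := -(t • X)) (y := t • X + h)
        (by rw [← neg_smul]; exact hX' _) (add_mem (hX' t) (Submodule.mem_sup_right hh))
      have h2 := H.add_mem h1 hh
      rwa [neg_add_cancel_left, sub_add_cancel] at h2
    have hα'p : α' (t • X + h) = bch K (t • X) (α p₁) := by simp only [α', ht, hp₁]
    obtain ⟨h1, h2⟩ := hαH p₁ hp₁H
    refine ⟨?_, ?_⟩
    · rw [hα'p]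
      exact bch_mem a (a.smul_mem t hXa) h1
    · have : (exp (bch K (t • X) (α p₁)) : ExpGroup K L)⁻¹ * exp (t • X + h) =
          (exp (α p₁))⁻¹ * ((exp (t • X))⁻¹ * exp (t • X + h)) := by
        rw [← exp_mul_exp, mul_inv_rev, mul_assoc]
      have h3 := congrArg ExpGroup.log this
      simp only [log_mul, log_inv] at h3
      rw [hα'p, h3]
      exact h2
  · intro h
    rw [h] at hXH
    exact hXH hXH'

end Factorization

end

noncomputable section

/-! ### Real and imaginary parts in the complexified Lie algebra -/

section Complexification

variable {𝔤 : Type*} [LieRing 𝔤] [LieAlgebra ℝ 𝔤]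

variable (𝔤) in
/-- The real part on `ℂ ⊗ 𝔤`. -/
def rePart : ℂ ⊗[ℝ] 𝔤 →ₗ[ℝ] 𝔤 :=
  (TensorProduct.lid ℝ 𝔤).toLinearMap ∘ₗ LinearMap.rTensor 𝔤 Complex.reLm

variable (𝔤) in
/-- The imaginary part on `ℂ ⊗ 𝔤`. -/
def imPart : ℂ ⊗[ℝ] 𝔤 →ₗ[ℝ] 𝔤 :=
  (TensorProduct.lid ℝ 𝔤).toLinearMap ∘ₗ LinearMap.rTensor 𝔤 Complex.imLm

@[simp]
lemma rePart_tmul (z : ℂ) (x : 𝔤) : rePart 𝔤 (z ⊗ₜ[ℝ] x) = z.re • x := by simp [rePart]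

@[simp]
lemma imPart_tmul (z : ℂ) (x : 𝔤) : imPart 𝔤 (z ⊗ₜ[ℝ] x) = z.im • x := by simp [imPart]

lemma rePart_add_imPart (v : ℂ ⊗[ℝ] 𝔤) :
    (1 : ℂ) ⊗ₜ[ℝ] rePart 𝔤 v + Complex.I ⊗ₜ[ℝ] imPart 𝔤 v = v := by
  induction v with
  | zero => simp
  | add v w hv hw =>
    conv_rhs => rw [← hv, ← hw]
    simp only [map_add, TensorProduct.tmul_add]
    abel
  | tmul z x =>
    rw [rePart_tmul, imPart_tmul, ← TensorProduct.smul_tmul, ← TensorProduct.smul_tmul,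
      ← TensorProduct.add_tmul]
    congr 1
    apply Complex.ext <;> simp

lemma complexification_ext {v w : ℂ ⊗[ℝ] 𝔤} (h1 : rePart 𝔤 v = rePart 𝔤 w)
    (h2 : imPart 𝔤 v = imPart 𝔤 w) : v = w := by
  rw [← rePart_add_imPart v, h1, h2, rePart_add_imPart]

@[simp]
lemma rePart_smul (z : ℂ) (v : ℂ ⊗[ℝ] 𝔤) :
    rePart 𝔤 (z • v) = z.re • rePart 𝔤 v - z.im • imPart 𝔤 v := by
  induction v with
  | zero => simp
  | add v w hv hw =>
    simp only [smul_add, map_add, hv, hw]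
    abel
  | tmul c x =>
    rw [TensorProduct.smul_tmul']
    simp [smul_smul, sub_smul]

@[simp]
lemma imPart_smul (z : ℂ) (v : ℂ ⊗[ℝ] 𝔤) :
    imPart 𝔤 (z • v) = z.re • imPart 𝔤 v + z.im • rePart 𝔤 v := by
  induction v with
  | zero => simp
  | add v w hv hw =>
    simp only [smul_add, map_add, hv, hw]
    abel
  | tmul c x =>
    rw [TensorProduct.smul_tmul']
    simp [smul_smul, add_smul]

lemma rePart_lie (v w : ℂ ⊗[ℝ] 𝔤) :
    rePart 𝔤 ⁅v, w⁆ = ⁅rePart 𝔤 v, rePart 𝔤 w⁆ - ⁅imPart 𝔤 v, imPart 𝔤 w⁆ := by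
  conv_lhs => rw [← rePart_add_imPart v, ← rePart_add_imPart w]
  simp only [add_lie, lie_add, LieAlgebra.ExtendScalars.bracket_tmul, map_add, rePart_tmul]
  simp [sub_eq_add_neg]

lemma imPart_lie (v w : ℂ ⊗[ℝ] 𝔤) :
    imPart 𝔤 ⁅v, w⁆ = ⁅rePart 𝔤 v, imPart 𝔤 w⁆ + ⁅imPart 𝔤 v, rePart 𝔤 w⁆ := by
  conv_lhs => rw [← rePart_add_imPart v, ← rePart_add_imPart w]
  simp only [add_lie, lie_add, LieAlgebra.ExtendScalars.bracket_tmul, map_add, imPart_tmul]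
  simp [add_comm]

/-- Dynkin's coefficients are rational and the nilpotency length does not involve the scalars. This
lets real subalgebras such as 𝔤 + i𝔫 be treated inside the complex group. -/
lemma bch_real_eq_complex (x y : ℂ ⊗[ℝ] 𝔤) : bch ℝ x y = bch ℂ x y := by
  unfold bch
  refine Finset.sum_congr rfl fun m _ => Finset.sum_congr rfl fun p _ => ?_
  rw [← algebraMap_smul ℂ]
  congr 1
  simp

instance [LieRing.IsNilpotent 𝔤] : LieRing.IsNilpotent (ℂ ⊗[ℝ] 𝔤) :=
  LieModule.instIsNilpotentTensor ℝ ℂ 𝔤 𝔤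

variable (𝔤) in
/-- The inclusion of `𝔤` in its complexification. -/
def toComplexification : 𝔤 →ₗ⁅ℝ⁆ ℂ ⊗[ℝ] 𝔤 :=
  { TensorProduct.mk ℝ ℂ 𝔤 1 with
    map_lie' := fun {x y} => by simp }

lemma ExpGroup.complexify_mul [LieRing.IsNilpotent 𝔤] (p q : ExpGroup ℝ 𝔤) :
    (p * q).complexify = p.complexify * q.complexify := by
  refine ExpGroup.ext ?_
  change toComplexification 𝔤 (bch ℝ p.log q.log) =
    bch ℂ (toComplexification 𝔤 p.log) (toComplexification 𝔤 q.log)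
  rw [LieHom.map_bch, bch_real_eq_complex]

lemma ExpGroup.complexify_injective :
    Function.Injective (ExpGroup.complexify : ExpGroup ℝ 𝔤 → _) := by
  intro p q h
  have := congrArg (fun r => rePart 𝔤 (ExpGroup.log r)) h
  exact ExpGroup.ext (by simpa [ExpGroup.complexify] using this)

end Complexification

/-! ### The subalgebras of a horizontal CR structure -/

namespace HorizontalCRStructure

variable {𝔤 : Type*} [LieRing 𝔤] [LieAlgebra ℝ 𝔤] (S : HorizontalCRStructure 𝔤)

/-- The projection to `𝔥` along `𝔫`. -/
def proj : 𝔤 →ₗ[ℝ] S.𝔥 := Submodule.projectionOnto _ _ S.isCompl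

@[simp]
lemma proj_coe (X : S.𝔥) : S.proj X = X := Submodule.projectionOnto_apply_left S.isCompl X

lemma proj_eq_zero_iff {x : 𝔤} : S.proj x = 0 ↔ x ∈ S.𝔫 :=
  Submodule.projectionOnto_apply_eq_zero_iff S.isCompl

/-- As 𝔫 is an ideal, brackets modulo 𝔫 depend only on the 𝔥-components. -/
lemma proj_proj_lie (x y : 𝔤) : S.proj ⁅(S.proj x : 𝔤), (S.proj y : 𝔤)⁆ = S.proj ⁅x, y⁆ := by
  have h : ∀ x, x - S.proj x ∈ S.𝔫 := fun x => by
    rw [← proj_eq_zero_iff, map_sub, proj_coe, sub_self]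
  rw [← sub_eq_zero, ← map_sub, proj_eq_zero_iff, ← neg_mem_iff]
  have : -(⁅(S.proj x : 𝔤), (S.proj y : 𝔤)⁆ - ⁅x, y⁆) =
      ⁅x - S.proj x, y⁆ + ⁅(S.proj x : 𝔤), y - S.proj y⁆ := by
    rw [sub_lie, lie_sub]
    abel
  rw [this]
  exact add_mem (lie_mem_left ℝ 𝔤 S.𝔫 _ _ (h x)) (lie_mem_right ℝ 𝔤 S.𝔫 _ _ (h y))

lemma J_proj_lie (X Y : S.𝔥) :
    S.J (S.proj (⁅(X : 𝔤), (Y : 𝔤)⁆ - ⁅(S.J X : 𝔤), (S.J Y : 𝔤)⁆)) =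
      S.proj (⁅(X : 𝔤), (S.J Y : 𝔤)⁆ + ⁅(S.J X : 𝔤), (Y : 𝔤)⁆) := by
  obtain ⟨Z, h1, h2⟩ := S.integrable X Y
  rw [← h1, ← h2, proj_coe, proj_coe]

lemma J_injective {X : S.𝔥} (h : S.J X = 0) : X = 0 := by
  have := S.J_J X
  rwa [h, map_zero, eq_comm, neg_eq_zero] at this

lemma mem_h01_iff {v : ℂ ⊗[ℝ] 𝔤} : v ∈ S.h01 ↔
    (S.proj (rePart 𝔤 v) : 𝔤) = rePart 𝔤 v ∧ (S.J (S.proj (rePart 𝔤 v)) : 𝔤) = imPart 𝔤 v := by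
  constructor
  · rintro ⟨X, rfl⟩
    simp
  · rintro ⟨h1, h2⟩
    refine ⟨S.proj (rePart 𝔤 v), ?_⟩
    beta_reduce
    rw [h2, h1, rePart_add_imPart]

/-- `𝔥⁰¹` as a complex subalgebra. -/
def subalgebra01 : LieSubalgebra ℂ (ℂ ⊗[ℝ] 𝔤) where
  carrier := S.h01
  add_mem' {v w} hv hw := by
    rw [mem_h01_iff] at *
    simp only [map_add, Submodule.coe_add, hv.1, hw.1, hv.2, hw.2, and_self]
  zero_mem' := by
    rw [mem_h01_iff]
    simp
  smul_mem' c v hv := by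
    rw [mem_h01_iff] at *
    obtain ⟨h1, h2⟩ := hv
    rw [rePart_smul, imPart_smul, ← h2, ← h1]
    simp [S.J_J, add_comm]
  lie_mem' {v w} hv hw := by
    obtain ⟨X, rfl⟩ := hv
    obtain ⟨Y, rfl⟩ := hw
    -- Integrability says precisely that the real and imaginary parts of [X + iJX, Y + iJY] are Z
    -- and JZ.
    obtain ⟨Z, h1, h2⟩ := S.integrable X Y
    refine ⟨Z, complexification_ext ?_ ?_⟩
    · rw [rePart_lie]
      simp [h1]
    · rw [imPart_lie]
      simp [h2]

/-- `𝔥⁰¹` as a real subalgebra. -/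
def realSubalgebra01 : LieSubalgebra ℝ (ℂ ⊗[ℝ] 𝔤) :=
  { S.subalgebra01.toSubmodule.restrictScalars ℝ with
    lie_mem' := fun hv hw => S.subalgebra01.lie_mem hv hw }

/-- `𝔪` as a complex subalgebra. -/
def subalgebraM : LieSubalgebra ℂ (ℂ ⊗[ℝ] 𝔤) where
  -- Modulo 𝔫_ℂ this condition describes the vectors X - iJX, so closure under brackets reduces to
  -- integrability projected to 𝔥.
  carrier := {v | S.proj (imPart 𝔤 v) = -S.J (S.proj (rePart 𝔤 v))}
  add_mem' {v w} hv hw := by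
    rw [Set.mem_ofPred_eq] at *
    simp only [map_add, hv, hw]
    abel
  zero_mem' := by simp
  smul_mem' c v hv := by
    rw [Set.mem_ofPred_eq] at *
    rw [rePart_smul, imPart_smul]
    simp only [map_add, map_sub, map_smul, hv, map_neg, S.J_J, smul_neg, neg_neg]
    abel
  lie_mem' {v w} hv hw := by
    rw [Set.mem_ofPred_eq] at *
    have h := S.J_proj_lie (S.proj (rePart 𝔤 v)) (S.proj (rePart 𝔤 w))
    rw [rePart_lie, imPart_lie, map_sub, map_add, ← S.proj_proj_lie (rePart 𝔤 v),
      ← S.proj_proj_lie (imPart 𝔤 v), ← S.proj_proj_lie (rePart 𝔤 v),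
      ← S.proj_proj_lie (imPart 𝔤 v), hv, hw]
    simp only [NegMemClass.coe_neg, lie_neg, neg_lie, neg_neg, map_neg]
    rw [← map_sub, h, map_add]
    abel

lemma mem_subalgebraM {v : ℂ ⊗[ℝ] 𝔤} :
    v ∈ S.subalgebraM ↔ S.proj (imPart 𝔤 v) = -S.J (S.proj (rePart 𝔤 v)) := Iff.rfl

/-- The real subalgebra `𝔤 + i𝔫`. -/
def subalgebraQ : LieSubalgebra ℝ (ℂ ⊗[ℝ] 𝔤) where
  carrier := {v | S.proj (imPart 𝔤 v) = 0}
  add_mem' {v w} hv hw := by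
    rw [Set.mem_ofPred_eq] at *
    simp only [map_add, hv, hw, add_zero]
  zero_mem' := by simp
  smul_mem' c v hv := by
    rw [Set.mem_ofPred_eq] at *
    rw [map_smul, map_smul, hv, smul_zero]
  lie_mem' {v w} hv hw := by
    rw [Set.mem_ofPred_eq] at *
    rw [imPart_lie, map_add, ← S.proj_proj_lie (rePart 𝔤 v), ← S.proj_proj_lie (imPart 𝔤 v), hv, hw]
    simp

lemma mem_subalgebraQ {v : ℂ ⊗[ℝ] 𝔤} : v ∈ S.subalgebraQ ↔ S.proj (imPart 𝔤 v) = 0 := Iff.rfl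

/-- The complexification of `𝔫`. -/
def subalgebraN : LieSubalgebra ℂ (ℂ ⊗[ℝ] 𝔤) where
  carrier := {v | S.proj (rePart 𝔤 v) = 0 ∧ S.proj (imPart 𝔤 v) = 0}
  add_mem' {v w} hv hw := by
    rw [Set.mem_ofPred_eq] at *
    simp only [map_add, hv, hw, add_zero, and_self]
  zero_mem' := by simp
  smul_mem' c v hv := by
    rw [Set.mem_ofPred_eq] at *
    simp [hv]
  lie_mem' {v w} hv hw := by
    rw [Set.mem_ofPred_eq] at *
    rw [rePart_lie, imPart_lie]
    simp only [map_add, map_sub, ← S.proj_proj_lie (rePart 𝔤 v), ← S.proj_proj_lie (imPart 𝔤 v),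
      hv, hw]
    simp

lemma mem_subalgebraN {v : ℂ ⊗[ℝ] 𝔤} :
    v ∈ S.subalgebraN ↔ S.proj (rePart 𝔤 v) = 0 ∧ S.proj (imPart 𝔤 v) = 0 := Iff.rfl

lemma mem_normalizer_subalgebraN (X : ℂ ⊗[ℝ] 𝔤) : X ∈ S.subalgebraN.normalizer := by
  rw [LieSubalgebra.mem_normalizer_iff]
  intro v hv
  rw [mem_subalgebraN] at *
  rw [rePart_lie, imPart_lie]
  simp only [map_add, map_sub, ← S.proj_proj_lie (rePart 𝔤 X), ← S.proj_proj_lie (imPart 𝔤 X), hv]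
  simp

lemma subalgebraN_le_subalgebraM : S.subalgebraN ≤ S.subalgebraM := fun v hv => by
  rw [mem_subalgebraN] at hv
  rw [mem_subalgebraM, hv.1, hv.2, map_zero, neg_zero]

lemma mem_𝔪_iff {v : ℂ ⊗[ℝ] 𝔤} : v ∈ S.𝔪 ↔ v ∈ S.subalgebraM := by
  constructor
  · intro hv
    have : S.𝔪 ≤ S.subalgebraM.toSubmodule := by
      refine sup_le (Submodule.span_le.2 ?_) ?_
      · rintro _ ⟨X, rfl⟩
        change _ = _
        simp
      · rw [Submodule.baseChange_eq_span]
        refine Submodule.span_le.2 ?_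
        rintro _ ⟨T, hT, rfl⟩
        have hT' : S.proj T = 0 := S.proj_eq_zero_iff.2 hT
        change _ = _
        simp [hT']
    exact this hv
  · intro hv
    rw [mem_subalgebraM] at hv
    set X := S.proj (rePart 𝔤 v) with hX
    have h1 : rePart 𝔤 v - X ∈ S.𝔫 := by
      rw [← proj_eq_zero_iff, map_sub, proj_coe, sub_self]
    have h2 : imPart 𝔤 v + S.J X ∈ S.𝔫 := by
      rw [← proj_eq_zero_iff, map_add, proj_coe, hv, neg_add_cancel]
    have h3 : v = ((1 : ℂ) ⊗ₜ[ℝ] (X : 𝔤) - Complex.I ⊗ₜ[ℝ] (S.J X : 𝔤)) +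
        ((1 : ℂ) ⊗ₜ[ℝ] (rePart 𝔤 v - X) + Complex.I ⊗ₜ[ℝ] (imPart 𝔤 v + S.J X)) := by
      refine complexification_ext ?_ ?_ <;> simp
    rw [h3]
    exact Submodule.add_mem_sup (Submodule.subset_span ⟨X, rfl⟩)
      (add_mem (Submodule.tmul_mem_baseChange_of_mem _ h1)
        (Submodule.tmul_mem_baseChange_of_mem _ h2))

lemma subalgebraM_sup_subalgebra01 :
    S.subalgebraM.toSubmodule ⊔ S.subalgebra01.toSubmodule = ⊤ := by
  refine eq_top_iff.2 fun v _ => ?_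
  -- Solves im v - JX = -J(re v - X) modulo 𝔫.
  set X : S.𝔥 := (2⁻¹ : ℝ) • (S.proj (rePart 𝔤 v) - S.J (S.proj (imPart 𝔤 v))) with hX
  refine Submodule.mem_sup.2 ⟨v - ((1 : ℂ) ⊗ₜ[ℝ] (X : 𝔤) + Complex.I ⊗ₜ[ℝ] (S.J X : 𝔤)), ?_,
    _, ⟨X, rfl⟩, sub_add_cancel _ _⟩
  change _ = _
  have hJX : S.J X = (2⁻¹ : ℝ) • (S.J (S.proj (rePart 𝔤 v)) + S.proj (imPart 𝔤 v)) := by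
    rw [hX, map_smul, map_sub, S.J_J, sub_neg_eq_add]
  simp only [map_sub, map_add, rePart_tmul, imPart_tmul, Complex.one_re, Complex.one_im,
    Complex.I_re, Complex.I_im, one_smul, zero_smul, add_zero, zero_add, proj_coe, hJX]
  module

lemma subalgebraQ_sup_realSubalgebra01 :
    S.subalgebraQ.toSubmodule ⊔ S.realSubalgebra01.toSubmodule = ⊤ := by
  refine eq_top_iff.2 fun v _ => ?_
  -- Chosen so that JX is the 𝔥-component of im v.
  set X : S.𝔥 := - S.J (S.proj (imPart 𝔤 v)) with hX
  refine Submodule.mem_sup.2 ⟨v - ((1 : ℂ) ⊗ₜ[ℝ] (X : 𝔤) + Complex.I ⊗ₜ[ℝ] (S.J X : 𝔤)), ?_,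
    _, ⟨X, rfl⟩, sub_add_cancel _ _⟩
  change _ = _
  have hJX : S.J X = S.proj (imPart 𝔤 v) := by rw [hX, map_neg, S.J_J, neg_neg]
  simp [hJX]

lemma eq_zero_of_mem_subalgebraM_of_mem_h01 {v : ℂ ⊗[ℝ] 𝔤} (h1 : v ∈ S.subalgebraM)
    (h2 : v ∈ S.h01) : v = 0 := by
  obtain ⟨X, rfl⟩ := h2
  rw [mem_subalgebraM] at h1
  have h3 : S.J X = -S.J X := by simpa using h1
  have h5 : (2 : ℝ) • S.J X = 0 := by
    rw [two_smul]
    nth_rewrite 1 [h3]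
    exact neg_add_cancel _
  have h4 : S.J X = 0 := (smul_eq_zero.1 h5).resolve_left two_ne_zero
  rw [S.J_injective h4]
  simp

lemma eq_zero_of_mem_subalgebraQ_of_mem_h01 {v : ℂ ⊗[ℝ] 𝔤} (h1 : v ∈ S.subalgebraQ)
    (h2 : v ∈ S.h01) : v = 0 := by
  obtain ⟨X, rfl⟩ := h2
  rw [mem_subalgebraQ] at h1
  have h4 : S.J X = 0 := by simpa using h1
  rw [S.J_injective h4]
  simp

/-! ### Adapted bases -/

/-- J turns 𝔥 into a complex vector space of dimension n; a complex basis b gives the real basis b,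
ib. -/
lemma nonempty_adaptedBasis [FiniteDimensional ℝ 𝔤] {n k : ℕ} (hS : S.IsOfType n k) :
    Nonempty (S.AdaptedBasis n k) := by
  have hJ : S.J * S.J = -1 := LinearMap.ext fun X => S.J_J X
  let ρ : ℂ →ₐ[ℝ] Module.End ℝ S.𝔥 := Complex.liftAux S.J hJ
  let _ : Module ℂ S.𝔥 := Module.compHom S.𝔥 ρ.toRingHom
  have hsmul : ∀ (z : ℂ) (X : S.𝔥), z • X = z.re • X + z.im • S.J X := fun z X => by
    change ρ z X = _
    simp [ρ, Complex.liftAux_apply, Algebra.algebraMap_eq_smul_one]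
  have : IsScalarTower ℝ ℂ S.𝔥 := ⟨fun r z X => by
    rw [hsmul, hsmul, smul_add, smul_smul, smul_smul]
    simp⟩
  have : FiniteDimensional ℂ S.𝔥 := FiniteDimensional.right ℝ ℂ S.𝔥
  have hn : Module.finrank ℂ S.𝔥 = n := by
    have h1 := Module.finrank_mul_finrank ℝ ℂ S.𝔥
    have h2 := hS.1
    rw [Complex.finrank_real_complex] at h1
    omega
  let b : Module.Basis (Fin n) ℂ S.𝔥 := Module.finBasisOfFinrankEq ℂ S.𝔥 hn
  let c : Module.Basis (Fin n ⊕ Fin n) ℝ S.𝔥 := (Complex.basisOneI.smulTower b).reindex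
    ((finTwoEquiv.prodCongr (Equiv.refl _)).trans (Equiv.boolProdEquivSum _))
  have hc1 : ∀ j, c (Sum.inl j) = b j := fun j => by
    have h0 : finTwoEquiv.symm false = 0 := rfl
    simp [c, Module.Basis.smulTower_apply, Equiv.boolProdEquivSum, h0]
  have hc2 : ∀ j, c (Sum.inr j) = Complex.I • b j := fun j => by
    have h0 : finTwoEquiv.symm true = 1 := rfl
    simp [c, Module.Basis.smulTower_apply, Equiv.boolProdEquivSum, h0]
  exact ⟨⟨c, fun j => by rw [hc1, hc2, hsmul]; simp, Module.finBasisOfFinrankEq ℝ S.𝔫 hS.2⟩⟩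

end HorizontalCRStructure

end

noncomputable section

/-! ### The factorisations `G_ℂ = M H⁰¹ = Q H⁰¹` -/

section

variable {𝔤 : Type*} [LieRing 𝔤] [LieAlgebra ℝ 𝔤] [LieRing.IsNilpotent 𝔤]

open ExpGroup

lemma Subgroup.eq_of_mul_eq_mul {G : Type*} [Group G] {A B : Subgroup G}
    (h : ∀ x ∈ A, x ∈ B → x = 1) {a a' b b' : G} (ha : a ∈ A) (ha' : a' ∈ A) (hb : b ∈ B)
    (hb' : b' ∈ B) (hab : a * b = a' * b') : a = a' := by
  have h1 : a'⁻¹ * a = b' * b⁻¹ := by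
    rw [eq_mul_inv_iff_mul_eq, mul_assoc, hab, inv_mul_cancel_left]
  have h2 := h _ (A.mul_mem (A.inv_mem ha') ha) (h1 ▸ B.mul_mem hb' (B.inv_mem hb))
  exact (inv_mul_eq_one.1 h2).symm

namespace HorizontalCRStructure

variable (S : HorizontalCRStructure 𝔤)

/-- The group of `𝔥⁰¹`. -/
def group01 : Subgroup (ExpGroup ℂ (ℂ ⊗[ℝ] 𝔤)) := ofSubalgebra S.subalgebra01

lemma mem_group01 {p : ExpGroup ℂ (ℂ ⊗[ℝ] 𝔤)} : p ∈ S.group01 ↔ p ∈ S.H01 := by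
  constructor
  · exact fun h => ⟨p.log, h, rfl⟩
  · rintro ⟨v, hv, rfl⟩
    exact hv

/-- The group of `𝔪`. -/
def groupM : Subgroup (ExpGroup ℂ (ℂ ⊗[ℝ] 𝔤)) := ofSubalgebra S.subalgebraM

/-- The group of `𝔤 + i𝔫`. -/
def groupQ : Subgroup (ExpGroup ℂ (ℂ ⊗[ℝ] 𝔤)) where
  carrier := {p | p.log ∈ S.subalgebraQ}
  mul_mem' {p q} hp hq := by
    have := bch_mem S.subalgebraQ hp hq
    rw [bch_real_eq_complex] at this
    exact this
  one_mem' := S.subalgebraQ.zero_mem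
  inv_mem' := fun hp => S.subalgebraQ.neg_mem hp

lemma complexify_mem_groupQ (p : ExpGroup ℝ 𝔤) : p.complexify ∈ S.groupQ := by
  change _ = _
  simp [ExpGroup.complexify]

lemma eq_of_groupM_mul_group01 {a a' b b' : ExpGroup ℂ (ℂ ⊗[ℝ] 𝔤)} (ha : a ∈ S.groupM)
    (ha' : a' ∈ S.groupM) (hb : b ∈ S.group01) (hb' : b' ∈ S.group01) (hab : a * b = a' * b') :
    a = a' :=
  Subgroup.eq_of_mul_eq_mul
    (fun _ h1 h2 => ExpGroup.ext (S.eq_zero_of_mem_subalgebraM_of_mem_h01 h1 h2)) ha ha' hb hb' hab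

lemma eq_of_groupQ_mul_group01 {a a' b b' : ExpGroup ℂ (ℂ ⊗[ℝ] 𝔤)} (ha : a ∈ S.groupQ)
    (ha' : a' ∈ S.groupQ) (hb : b ∈ S.group01) (hb' : b' ∈ S.group01) (hab : a * b = a' * b') :
    a = a' :=
  Subgroup.eq_of_mul_eq_mul
    (fun _ h1 h2 => ExpGroup.ext (S.eq_zero_of_mem_subalgebraQ_of_mem_h01 h1 h2)) ha ha' hb hb' hab

/-- Right multiplication by elements of the group of `𝔫_ℂ` only changes logarithms by elements
of `𝔫_ℂ`. -/
lemma inv_mul_log_mem_subalgebraN_iff {p q : ExpGroup ℂ (ℂ ⊗[ℝ] 𝔤)} :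
    (p⁻¹ * q).log ∈ S.subalgebraN ↔ q.log - p.log ∈ S.subalgebraN := by
  have hself : ∀ (c : ℂ) (x : ℂ ⊗[ℝ] 𝔤), c • x ∈ (ℂ ∙ x) ⊔ S.subalgebraN.toSubmodule := fun c x =>
    Submodule.mem_sup_left (Submodule.smul_mem _ _ (Submodule.mem_span_singleton_self x))
  constructor
  · intro h
    have h1 := bch_sub_add_mem_of_mem_normalizer (S.mem_normalizer_subalgebraN p.log)
      (x := p.log) (y := (p⁻¹ * q).log) (by simpa using hself 1 p.log) (Submodule.mem_sup_right h)
    rw [← log_mul, mul_inv_cancel_left] at h1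
    have h2 := S.subalgebraN.add_mem h1 h
    convert h2 using 1
    abel
  · intro h
    have h1 := bch_sub_add_mem_of_mem_normalizer (S.mem_normalizer_subalgebraN p.log)
      (x := -p.log) (y := q.log) (by simpa using hself (-1) p.log) (by
        have := add_mem (hself 1 p.log) (Submodule.mem_sup_right (S := ℂ ∙ p.log) h)
        rwa [one_smul, add_sub_cancel] at this)
    have h2 := S.subalgebraN.add_mem h1 h
    rw [log_mul, log_inv]
    convert h2 using 1
    abel

/-- Normality of exp 𝔫_ℂ: the logarithms of pq and p agree modulo 𝔫_ℂ, hence so do those of their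
inverses, and the preceding criterion applies to these. -/
lemma conj_log_mem_subalgebraN {p q : ExpGroup ℂ (ℂ ⊗[ℝ] 𝔤)} (hq : q.log ∈ S.subalgebraN) :
    (p * q * p⁻¹).log ∈ S.subalgebraN := by
  have h1 : (p * q).log - p.log ∈ S.subalgebraN := by
    rw [← S.inv_mul_log_mem_subalgebraN_iff, inv_mul_cancel_left]
    exact hq
  have h2 : ((p * q)⁻¹).log - p⁻¹.log ∈ S.subalgebraN := by
    rw [log_inv, log_inv, neg_sub_neg, ← neg_sub]
    exact S.subalgebraN.neg_mem h1
  have h3 := (S.inv_mul_log_mem_subalgebraN_iff).2 h2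
  rw [inv_inv] at h3
  have h4 := S.subalgebraN.neg_mem h3
  rw [← log_inv, mul_inv_rev, inv_inv] at h4
  exact h4

variable [FiniteDimensional ℝ 𝔤]

/-- The logarithm of the factor in `M` of a point of `G_ℂ`. -/
def factorM : ℂ ⊗[ℝ] 𝔤 → ℂ ⊗[ℝ] 𝔤 :=
  (exists_isPolyMap_factor S.subalgebraM S.subalgebra01 S.subalgebraM_sup_subalgebra01).choose

lemma isPolyMap_factorM : IsPolyMap ℂ S.factorM :=
  (exists_isPolyMap_factor S.subalgebraM S.subalgebra01
    S.subalgebraM_sup_subalgebra01).choose_spec.1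

lemma factorM_mem (v : ℂ ⊗[ℝ] 𝔤) : S.factorM v ∈ S.subalgebraM :=
  ((exists_isPolyMap_factor S.subalgebraM S.subalgebra01
    S.subalgebraM_sup_subalgebra01).choose_spec.2 v).1

lemma inv_factorM_mul_mem (p : ExpGroup ℂ (ℂ ⊗[ℝ] 𝔤)) :
    (exp (S.factorM p.log))⁻¹ * p ∈ S.group01 :=
  ((exists_isPolyMap_factor S.subalgebraM S.subalgebra01
    S.subalgebraM_sup_subalgebra01).choose_spec.2 p.log).2

/-- The logarithm of the factor in the group of `𝔤 + i𝔫` of a point of `G_ℂ`. -/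
def factorQ : ℂ ⊗[ℝ] 𝔤 → ℂ ⊗[ℝ] 𝔤 :=
  (exists_isPolyMap_factor S.subalgebraQ S.realSubalgebra01
    S.subalgebraQ_sup_realSubalgebra01).choose

lemma isPolyMap_factorQ : IsPolyMap ℝ S.factorQ :=
  (exists_isPolyMap_factor S.subalgebraQ S.realSubalgebra01
    S.subalgebraQ_sup_realSubalgebra01).choose_spec.1

lemma factorQ_mem (v : ℂ ⊗[ℝ] 𝔤) : S.factorQ v ∈ S.subalgebraQ :=
  ((exists_isPolyMap_factor S.subalgebraQ S.realSubalgebra01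
    S.subalgebraQ_sup_realSubalgebra01).choose_spec.2 v).1

lemma inv_factorQ_mul_mem (p : ExpGroup ℂ (ℂ ⊗[ℝ] 𝔤)) :
    (exp (S.factorQ p.log))⁻¹ * p ∈ S.group01 := by
  have := ((exists_isPolyMap_factor S.subalgebraQ S.realSubalgebra01
    S.subalgebraQ_sup_realSubalgebra01).choose_spec.2 p.log).2
  rw [bch_real_eq_complex] at this
  exact this

/-- Constancy on left cosets of H⁰¹, the source of the CR condition. -/
lemma factorM_eq_of_mul_mem {p b : ExpGroup ℂ (ℂ ⊗[ℝ] 𝔤)} (hb : b ∈ S.group01) :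
    S.factorM (p * b).log = S.factorM p.log := by
  have h := S.eq_of_groupM_mul_group01 (a := exp (S.factorM (p * b).log))
    (a' := exp (S.factorM p.log)) (S.factorM_mem (p * b).log) (S.factorM_mem p.log)
    (S.inv_factorM_mul_mem (p * b)) (S.group01.mul_mem (S.inv_factorM_mul_mem p) hb)
    (by rw [mul_inv_cancel_left, ← mul_assoc, mul_inv_cancel_left])
  exact congrArg ExpGroup.log h

/-- The factor in `M` modulo `𝔫_ℂ` depends only on the point modulo `𝔫_ℂ`. -/
lemma factorM_sub_mem_subalgebraN {v w : ℂ ⊗[ℝ] 𝔤} (h : w - v ∈ S.subalgebraN) :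
    S.factorM w - S.factorM v ∈ S.subalgebraN := by
  set p : ExpGroup ℂ (ℂ ⊗[ℝ] 𝔤) := exp v
  set q : ExpGroup ℂ (ℂ ⊗[ℝ] 𝔤) := exp w
  set m : ExpGroup ℂ (ℂ ⊗[ℝ] 𝔤) := exp (S.factorM v)
  set m' : ExpGroup ℂ (ℂ ⊗[ℝ] 𝔤) := exp (S.factorM w)
  have hb : m⁻¹ * p ∈ S.group01 := S.inv_factorM_mul_mem p
  have hb' : m'⁻¹ * q ∈ S.group01 := S.inv_factorM_mul_mem q
  have hν : (p⁻¹ * q).log ∈ S.subalgebraN := S.inv_mul_log_mem_subalgebraN_iff.2 h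
  have hν' := S.conj_log_mem_subalgebraN (p := m⁻¹ * p) hν
  -- With p = mb and q = pν one has q = m(bνb⁻¹)b, and bνb⁻¹ = r lies in exp 𝔫_ℂ, which is part of
  -- M.
  set r := m⁻¹ * p * (p⁻¹ * q) * (m⁻¹ * p)⁻¹ with hr
  have hmm : m' = m * r := by
    refine S.eq_of_groupM_mul_group01 (b := m'⁻¹ * q) (b' := m⁻¹ * p) (S.factorM_mem w)
      (S.groupM.mul_mem (S.factorM_mem v) (S.subalgebraN_le_subalgebraM hν')) hb' hb ?_
    rw [hr]
    group
  change m'.log - m.log ∈ _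
  rw [← S.inv_mul_log_mem_subalgebraN_iff, hmm, inv_mul_cancel_left]
  exact hν'

end HorizontalCRStructure

end

/-! ### Coordinates -/

namespace HorizontalCRStructure.AdaptedBasis

variable {𝔤 : Type*} [LieRing 𝔤] [LieAlgebra ℝ 𝔤] {S : HorizontalCRStructure 𝔤} {n k : ℕ}
  (B : S.AdaptedBasis n k)

/-- The logarithm of `chart`, as a linear map. -/
def chartLin : ((Fin n → ℝ) × (Fin n → ℝ) × (Fin k → ℝ)) →ₗ[ℝ] 𝔤 where
  toFun a := (B.chart a).log
  map_add' a b := by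
    simp only [chart, Prod.fst_add, Prod.snd_add, Pi.add_apply, add_smul, Finset.sum_add_distrib]
    abel
  map_smul' c a := by
    simp only [chart, Prod.smul_fst, Prod.smul_snd, Pi.smul_apply, smul_eq_mul, RingHom.id_apply,
      smul_add, Finset.smul_sum, smul_smul]

/-- The logarithm of `chartM`, as a linear map. -/
def chartMLin : CSpace n k →ₗ[ℂ] ℂ ⊗[ℝ] 𝔤 where
  toFun v := (B.chartM v).log
  map_add' a b := by
    simp only [chartM, Prod.fst_add, Prod.snd_add, Pi.add_apply, add_div, add_smul,
      Finset.sum_add_distrib]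
    abel
  map_smul' c a := by
    simp only [chartM, Prod.smul_fst, Prod.smul_snd, Pi.smul_apply, smul_eq_mul, RingHom.id_apply,
      smul_add, Finset.smul_sum, smul_smul, mul_div_assoc]

lemma chartLin_eq (a : (Fin n → ℝ) × (Fin n → ℝ) × (Fin k → ℝ)) :
    B.chartLin a = (B.X.equivFun.symm (Sum.elim a.1 a.2.1) : 𝔤) +
      (B.T.equivFun.symm a.2.2 : 𝔤) := by
  simp [chartLin, chart, Module.Basis.equivFun_symm_apply, Finset.sum_add_distrib]

lemma proj_chartLin (a : (Fin n → ℝ) × (Fin n → ℝ) × (Fin k → ℝ)) :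
    S.proj (B.chartLin a) = B.X.equivFun.symm (Sum.elim a.1 a.2.1) := by
  rw [chartLin_eq, map_add, proj_coe, S.proj_eq_zero_iff.2 (SetLike.coe_mem _), add_zero]

lemma eq_zero_of_proj_chartLin {a : (Fin n → ℝ) × (Fin n → ℝ) × (Fin k → ℝ)}
    (h : S.proj (B.chartLin a) = 0) : a.1 = 0 ∧ a.2.1 = 0 := by
  rw [proj_chartLin, LinearEquiv.map_eq_zero_iff] at h
  exact ⟨funext fun j => congrFun h (Sum.inl j), funext fun j => congrFun h (Sum.inr j)⟩

lemma chartLin_injective : Function.Injective B.chartLin := by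
  rw [injective_iff_map_eq_zero]
  intro a ha
  have h1 := B.eq_zero_of_proj_chartLin (by rw [ha, map_zero])
  rw [chartLin_eq, h1.1, h1.2] at ha
  have h2 : Sum.elim (0 : Fin n → ℝ) (0 : Fin n → ℝ) = 0 := by
    funext i
    cases i <;> rfl
  rw [h2, map_zero, ZeroMemClass.coe_zero, zero_add, ZeroMemClass.coe_eq_zero,
    LinearEquiv.map_eq_zero_iff] at ha
  exact Prod.ext h1.1 (Prod.ext h1.2 ha)

lemma rePart_chartMLin (v : CSpace n k) : rePart 𝔤 (B.chartMLin v) =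
    B.chartLin (fun j => (v.1 j).re / 2, fun j => (v.1 j).im / 2, fun l => (v.2 l).re) := by
  change rePart 𝔤 (B.chartM v).log = (B.chart _).log
  simp [chartM, chart]

lemma imPart_chartMLin (v : CSpace n k) : imPart 𝔤 (B.chartMLin v) =
    B.chartLin (fun j => (v.1 j).im / 2, fun j => -((v.1 j).re / 2), fun l => (v.2 l).im) := by
  change imPart 𝔤 (B.chartM v).log = (B.chart _).log
  simp [chartM, chart, add_comm]

lemma chartMLin_injective : Function.Injective B.chartMLin := by
  rw [injective_iff_map_eq_zero]
  intro v hv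
  have h1 := B.rePart_chartMLin v
  have h2 := B.imPart_chartMLin v
  rw [hv, map_zero, eq_comm, ← map_zero B.chartLin] at h1 h2
  have h1' := B.chartLin_injective h1
  have h2' := B.chartLin_injective h2
  simp only [Prod.ext_iff, funext_iff, Prod.fst_zero, Prod.snd_zero, Pi.zero_apply] at h1' h2' ⊢
  exact ⟨fun j => Complex.ext (by simpa using h1'.1 j) (by simpa using h2'.1 j),
    fun l => Complex.ext (h1'.2.2 l) (h2'.2.2 l)⟩

lemma chartMLin_mem (v : CSpace n k) : B.chartMLin v ∈ S.subalgebraM := by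
  rw [← mem_𝔪_iff]
  refine add_mem (sum_mem fun j _ => Submodule.smul_mem _ _ ?_)
    (sum_mem fun l _ => Submodule.smul_mem _ _ ?_)
  · rw [B.X_inr]
    exact Submodule.mem_sup_left (Submodule.subset_span ⟨_, rfl⟩)
  · exact Submodule.mem_sup_right (Submodule.tmul_mem_baseChange_of_mem _ (B.T l).2)

lemma mem_range_chartMLin {u : ℂ ⊗[ℝ] 𝔤} (hu : u ∈ S.subalgebraM) :
    u ∈ LinearMap.range B.chartMLin := by
  rw [mem_subalgebraM] at hu
  set a := B.X.equivFun (S.proj (rePart 𝔤 u)) with ha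
  have hN : ∀ x : 𝔤, S.proj x = 0 → ∃ t : Fin k → ℝ, B.chartLin (0, 0, t) = x := by
    intro x hx
    rw [S.proj_eq_zero_iff] at hx
    refine ⟨B.T.equivFun ⟨x, hx⟩, ?_⟩
    have h2 : Sum.elim (0 : Fin n → ℝ) (0 : Fin n → ℝ) = 0 := by
      funext i
      cases i <;> rfl
    rw [chartLin_eq, h2, map_zero, LinearEquiv.symm_apply_apply]
    simp
  obtain ⟨t, ht⟩ := hN (rePart 𝔤 u - S.proj (rePart 𝔤 u)) (by simp)
  obtain ⟨s, hs⟩ := hN (imPart 𝔤 u - S.proj (imPart 𝔤 u)) (by simp)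
  have hchart : ∀ (x y : Fin n → ℝ) (t : Fin k → ℝ),
      B.chartLin (x, y, t) = B.chartLin (x, y, 0) + B.chartLin (0, 0, t) := fun x y t => by
    rw [← map_add]
    simp
  let x : Fin n → ℝ := fun j => a (Sum.inl j)
  let y : Fin n → ℝ := fun j => a (Sum.inr j)
  have hre : B.chartLin (x, y, 0) = S.proj (rePart 𝔤 u) := by
    have hxy : Sum.elim x y = a := by
      funext i
      cases i <;> rfl
    rw [chartLin_eq, hxy, ha, LinearEquiv.symm_apply_apply]
    simp
  have hJ : S.J (S.proj (rePart 𝔤 u)) = B.X.equivFun.symm (Sum.elim (-y) x) := by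
    rw [← B.X.equivFun.symm_apply_apply (S.proj (rePart 𝔤 u)), ← ha]
    simp [Module.Basis.equivFun_symm_apply, B.X_inr, S.J_J, x, y, add_comm]
  -- The factor 2 undoes the halves in `chartM`.
  refine ⟨(fun j => ⟨2 * x j, 2 * y j⟩, fun l => ⟨t l, s l⟩), complexification_ext ?_ ?_⟩
  · rw [rePart_chartMLin]
    simp only [mul_div_cancel_left₀ _ (two_ne_zero' ℝ)]
    rw [hchart, ht]
    change B.chartLin (x, y, 0) + _ = _
    rw [hre, add_sub_cancel]
  · rw [imPart_chartMLin]
    simp only [mul_div_cancel_left₀ _ (two_ne_zero' ℝ)]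
    rw [hchart, hs]
    have hneg : Sum.elim y (-x) = -Sum.elim (-y) x := by
      funext i
      cases i <;> simp
    have him : B.chartLin (y, -x, 0) = S.proj (imPart 𝔤 u) := by
      rw [chartLin_eq, hneg, map_neg, ← hJ, hu]
      simp
    change B.chartLin (y, -x, 0) + _ = _
    rw [him, add_sub_cancel]

end HorizontalCRStructure.AdaptedBasis

end

noncomputable section

/-! ### The embedding -/

namespace HorizontalCRStructure.AdaptedBasis

open ExpGroup

variable {𝔤 : Type*} [LieRing 𝔤] [LieAlgebra ℝ 𝔤] {S : HorizontalCRStructure 𝔤} {n k : ℕ}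
  (B : S.AdaptedBasis n k)

lemma chartM_injective : Function.Injective B.chartM := fun _ _ h =>
  B.chartMLin_injective (congrArg ExpGroup.log h)

lemma range_chartM : Set.range B.chartM = S.M := by
  ext p
  constructor
  · rintro ⟨v, rfl⟩
    exact ⟨B.chartMLin v, S.mem_𝔪_iff.2 (B.chartMLin_mem v), rfl⟩
  · rintro ⟨u, hu, rfl⟩
    obtain ⟨v, hv⟩ := B.mem_range_chartMLin (S.mem_𝔪_iff.1 hu)
    exact ⟨v, congrArg ExpGroup.exp hv⟩

/-- A linear left inverse of `chartLin`. -/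
def chartInv : 𝔤 →ₗ[ℝ] (Fin n → ℝ) × (Fin n → ℝ) × (Fin k → ℝ) :=
  (LinearMap.exists_leftInverse_of_injective B.chartLin
    (LinearMap.ker_eq_bot.2 B.chartLin_injective)).choose

lemma chartInv_chartLin (a : (Fin n → ℝ) × (Fin n → ℝ) × (Fin k → ℝ)) :
    B.chartInv (B.chartLin a) = a :=
  LinearMap.congr_fun (LinearMap.exists_leftInverse_of_injective B.chartLin
    (LinearMap.ker_eq_bot.2 B.chartLin_injective)).choose_spec a

/-- A linear left inverse of `chartMLin`. -/
def chartMInv : ℂ ⊗[ℝ] 𝔤 →ₗ[ℂ] CSpace n k :=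
  (LinearMap.exists_leftInverse_of_injective B.chartMLin
    (LinearMap.ker_eq_bot.2 B.chartMLin_injective)).choose

lemma chartMInv_chartMLin (v : CSpace n k) : B.chartMInv (B.chartMLin v) = v :=
  LinearMap.congr_fun (LinearMap.exists_leftInverse_of_injective B.chartMLin
    (LinearMap.ker_eq_bot.2 B.chartMLin_injective)).choose_spec v

lemma chartMLin_chartMInv {u : ℂ ⊗[ℝ] 𝔤} (hu : u ∈ S.subalgebraM) :
    B.chartMLin (B.chartMInv u) = u := by
  obtain ⟨v, rfl⟩ := B.mem_range_chartMLin hu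
  rw [chartMInv_chartMLin]

lemma fst_chartMInv_eq_zero {u : ℂ ⊗[ℝ] 𝔤} (hu : u ∈ S.subalgebraN) : (B.chartMInv u).1 = 0 := by
  have h := B.chartMLin_chartMInv (S.subalgebraN_le_subalgebraM hu)
  rw [mem_subalgebraN, ← h, rePart_chartMLin] at hu
  obtain ⟨h1, h2⟩ := B.eq_zero_of_proj_chartLin hu.1
  funext j
  exact Complex.ext (by simpa using congrFun h1 j) (by simpa using congrFun h2 j)

/-- The complex linear extension of `chartLin`. -/
def complexChart : ((Fin n ⊕ Fin n) ⊕ Fin k → ℂ) →ₗ[ℂ] ℂ ⊗[ℝ] 𝔤 :=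
  Fintype.linearCombination ℂ (Sum.elim (fun i => (1 : ℂ) ⊗ₜ[ℝ] (B.X i : 𝔤))
    fun l => (1 : ℂ) ⊗ₜ[ℝ] (B.T l : 𝔤))

/-- The inclusion of the real coordinates in the complex ones. -/
def ofRealCoord (a : (Fin n → ℝ) × (Fin n → ℝ) × (Fin k → ℝ)) : (Fin n ⊕ Fin n) ⊕ Fin k → ℂ :=
  Sum.elim (Sum.elim (fun i => (a.1 i : ℂ)) fun i => (a.2.1 i : ℂ)) fun l => (a.2.2 l : ℂ)

lemma contDiff_ofRealCoord : ContDiff ℝ ∞ (ofRealCoord (n := n) (k := k)) := by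
  rw [contDiff_pi]
  rintro ((i | i) | i)
  · exact Complex.ofRealCLM.contDiff.comp (by fun_prop)
  · exact Complex.ofRealCLM.contDiff.comp (by fun_prop)
  · exact Complex.ofRealCLM.contDiff.comp (by fun_prop)

lemma complexChart_ofRealCoord (a : (Fin n → ℝ) × (Fin n → ℝ) × (Fin k → ℝ)) :
    B.complexChart (ofRealCoord a) = (1 : ℂ) ⊗ₜ[ℝ] B.chartLin a := by
  apply complexification_ext <;>
  simp [-Complex.coe_smul, complexChart, ofRealCoord, Fintype.linearCombination_apply, chartLin,
    chart, Finset.sum_add_distrib]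

lemma complexChart_sub_mem (u : Fin n ⊕ Fin n → ℂ) (t : Fin k → ℂ) :
    B.complexChart (Sum.elim u t) - B.complexChart (Sum.elim u 0) ∈ S.subalgebraN := by
  rw [mem_subalgebraN, ← map_sub]
  have h : ∀ l, S.proj (B.T l : 𝔤) = 0 := fun l => S.proj_eq_zero_iff.2 (B.T l).2
  simp [complexChart, Fintype.linearCombination_apply, h]

variable [LieRing.IsNilpotent 𝔤] [FiniteDimensional ℝ 𝔤]

/-- The map `Φ : G_ℂ → M ≅ ℂⁿ⁺ᵏ`. -/
def mapM (p : ExpGroup ℂ (ℂ ⊗[ℝ] 𝔤)) : CSpace n k := B.chartMInv (S.factorM p.log)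

lemma chartM_mapM (p : ExpGroup ℂ (ℂ ⊗[ℝ] 𝔤)) : B.chartM (B.mapM p) = exp (S.factorM p.log) :=
  congrArg ExpGroup.exp (B.chartMLin_chartMInv (S.factorM_mem p.log))

lemma mapM_eq_iff {p : ExpGroup ℂ (ℂ ⊗[ℝ] 𝔤)} {v : CSpace n k} :
    B.mapM p = v ↔ ∃ b ∈ S.H01, B.chartM v * b = p := by
  constructor
  · rintro rfl
    refine ⟨_, S.mem_group01.1 (S.inv_factorM_mul_mem p), ?_⟩
    rw [chartM_mapM, mul_inv_cancel_left]
  · rintro ⟨b, hb, rfl⟩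
    apply B.chartM_injective
    rw [chartM_mapM]
    exact S.eq_of_groupM_mul_group01 (a' := B.chartM v) (S.factorM_mem _) (B.chartMLin_mem v)
      (S.inv_factorM_mul_mem _) (S.mem_group01.2 hb) (mul_inv_cancel_left _ _)

/-- The right inverse of `mapM` with values in the group of `𝔤 + i𝔫`. -/
def liftQ (v : CSpace n k) : ExpGroup ℂ (ℂ ⊗[ℝ] 𝔤) := exp (S.factorQ (B.chartMLin v))

lemma liftQ_mem (v : CSpace n k) : B.liftQ v ∈ S.groupQ := S.factorQ_mem _

lemma inv_liftQ_mul_chartM_mem (v : CSpace n k) : (B.liftQ v)⁻¹ * B.chartM v ∈ S.group01 :=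
  S.inv_factorQ_mul_mem (B.chartM v)

/-- The point of M with coordinates v and its factor in Q lie in one coset of H⁰¹. -/
lemma mapM_liftQ (v : CSpace n k) : B.mapM (B.liftQ v) = v :=
  B.mapM_eq_iff.2 ⟨_, S.mem_group01.1 (S.group01.inv_mem (B.inv_liftQ_mul_chartM_mem v)), by group⟩

/-- Q meets each coset of H⁰¹ only once, so Φ restricted to Q is a bijection. -/
lemma liftQ_mapM {p : ExpGroup ℂ (ℂ ⊗[ℝ] 𝔤)} (hp : p ∈ S.groupQ) : B.liftQ (B.mapM p) = p := by
  obtain ⟨b, hb, hbp⟩ := B.mapM_eq_iff.1 (rfl : B.mapM p = B.mapM p)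
  refine S.eq_of_groupQ_mul_group01 (b' := b⁻¹) (B.liftQ_mem _) hp
    (B.inv_liftQ_mul_chartM_mem (B.mapM p)) (S.group01.inv_mem (S.mem_group01.2 hb)) ?_
  rw [mul_inv_cancel_left, eq_mul_inv_iff_mul_eq, hbp]

/-- The restriction of `mapM` to `G`. -/
def embed (p : ExpGroup ℝ 𝔤) : CSpace n k := B.mapM p.complexify

lemma liftQ_embed (p : ExpGroup ℝ 𝔤) : B.liftQ (B.embed p) = p.complexify :=
  B.liftQ_mapM (S.complexify_mem_groupQ p)

lemma embed_injective : Function.Injective B.embed := fun p q h =>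
  complexify_injective (by rw [← B.liftQ_embed, h, B.liftQ_embed])

/-- `ℂⁿ⁺ᵏ` as the group of `𝔤 + i𝔫`. -/
def equivQ : CSpace n k ≃ S.groupQ where
  toFun v := ⟨B.liftQ v, B.liftQ_mem v⟩
  invFun p := B.mapM p
  left_inv := B.mapM_liftQ
  right_inv p := Subtype.ext (B.liftQ_mapM p.2)

/-- `mapM` in complex coordinates. -/
def embedComplex (v : (Fin n ⊕ Fin n) ⊕ Fin k → ℂ) : CSpace n k :=
  B.chartMInv (S.factorM (B.complexChart v))

lemma isPolyMap_embedComplex : IsPolyMap ℂ B.embedComplex :=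
  (S.isPolyMap_factorM.comp B.complexChart.isPolyMap).linear_comp _

lemma embed_chart (a : (Fin n → ℝ) × (Fin n → ℝ) × (Fin k → ℝ)) :
    B.embed (B.chart a) = B.embedComplex (ofRealCoord a) := by
  rw [embedComplex, complexChart_ofRealCoord]
  rfl

lemma contDiff_embed_chart : ContDiff ℝ ∞ fun a => B.embed (B.chart a) := by
  simp only [embed_chart]
  exact (B.isPolyMap_embedComplex.contDiff.restrict_scalars ℝ).comp contDiff_ofRealCoord

/-- A smooth left inverse of the embedding in coordinates. -/
def embedInv (v : CSpace n k) : (Fin n → ℝ) × (Fin n → ℝ) × (Fin k → ℝ) :=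
  B.chartInv (rePart 𝔤 (B.liftQ v).log)

lemma embedInv_embed_chart (a : (Fin n → ℝ) × (Fin n → ℝ) × (Fin k → ℝ)) :
    B.embedInv (B.embed (B.chart a)) = a := by
  rw [embedInv, liftQ_embed, complexify, rePart_tmul, Complex.one_re, one_smul]
  exact B.chartInv_chartLin a

lemma contDiff_embedInv : ContDiff ℝ ∞ B.embedInv :=
  IsPolyMap.contDiff (((S.isPolyMap_factorQ.comp
    (B.chartMLin.restrictScalars ℝ).isPolyMap).linear_comp (rePart 𝔤)).linear_comp B.chartInv)

lemma isEmbedding_embed_chart : Topology.IsEmbedding fun a => B.embed (B.chart a) :=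
  Function.LeftInverse.isEmbedding B.embedInv_embed_chart B.contDiff_embedInv.continuous
    B.contDiff_embed_chart.continuous

/-- The chain rule for the smooth left inverse gives a left inverse of the differential. -/
lemma fderiv_embed_chart_injective (a : (Fin n → ℝ) × (Fin n → ℝ) × (Fin k → ℝ)) :
    Function.Injective (fderiv ℝ (fun a => B.embed (B.chart a)) a) := by
  have h1 := ((B.contDiff_embedInv.differentiable (by simp))
    (B.embed (B.chart a))).hasFDerivAt.comp a
    ((B.contDiff_embed_chart.differentiable (by simp)) a).hasFDerivAt
  have h2 : B.embedInv ∘ (fun a => B.embed (B.chart a)) = id := funext B.embedInv_embed_chart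
  rw [h2] at h1
  have h3 := h1.unique (hasFDerivAt_id a)
  intro x y hxy
  have := congrArg (fderiv ℝ B.embedInv (B.embed (B.chart a))) hxy
  rw [← ContinuousLinearMap.comp_apply, ← ContinuousLinearMap.comp_apply, h3] at this
  exact this

/-- The two real curves are axes of a map holomorphic in two complex variables. Its differential
kills (1, i), since exp(s(X + iJX)) lies in H⁰¹, and complex linearity then relates the two
velocities. -/
lemma exists_hasDerivAt_embed (p : ExpGroup ℝ 𝔤) (X : S.𝔥) : ∃ v : CSpace n k,
    HasDerivAt (fun t : ℝ => B.embed (p * exp (t • (X : 𝔤)))) v 0 ∧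
    HasDerivAt (fun t : ℝ => B.embed (p * exp (t • (S.J X : 𝔤)))) (Complex.I • v) 0 := by
  let ψ : ℂ × ℂ → CSpace n k := fun c => B.mapM (p.complexify *
    exp (c.1 • ((1 : ℂ) ⊗ₜ[ℝ] (X : 𝔤)) + c.2 • ((1 : ℂ) ⊗ₜ[ℝ] (S.J X : 𝔤))))
  have hψ : IsPolyMap ℂ ψ := by
    refine IsPolyMap.linear_comp _ (S.isPolyMap_factorM.comp (IsPolyMap.bch (isPolyMap_const _) ?_))
    exact ((LinearMap.fst ℂ ℂ ℂ).isPolyMap.smul (isPolyMap_const _)).add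
      ((LinearMap.snd ℂ ℂ ℂ).isPolyMap.smul (isPolyMap_const _))
  have hD := ((hψ.contDiff.differentiable (by simp)) 0).hasFDerivAt
  set D := fderiv ℂ ψ 0
  have hline : ∀ c : ℂ × ℂ, HasDerivAt (fun s : ℂ => ψ (s • c)) (D c) 0 := fun c => by
    have h : HasDerivAt (fun s : ℂ => s • c) c 0 := by
      simpa using (hasDerivAt_id (0 : ℂ)).smul_const c
    have hD' : HasFDerivAt ψ D ((0 : ℂ) • c) := by rwa [zero_smul]
    exact hD'.comp_hasDerivAt (0 : ℂ) h
  have hreal : ∀ c : ℂ × ℂ, HasDerivAt (fun t : ℝ => ψ ((t : ℂ) • c)) (D c) 0 := fun c => by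
    have h := (hline c)
    rw [← Complex.ofReal_zero] at h
    have h' := h.scomp (0 : ℝ) Complex.ofRealCLM.hasDerivAt
    rw [Complex.ofRealCLM_apply, Complex.ofReal_one, one_smul] at h'
    exact h'
  have h0 : D (1, Complex.I) = 0 := by
    refine (hline (1, Complex.I)).unique ?_
    have h : (fun s : ℂ => ψ (s • (1, Complex.I))) = fun _ => B.mapM p.complexify := by
      funext s
      refine congrArg B.chartMInv (S.factorM_eq_of_mul_mem ?_)
      have h1 : (1 : ℂ) ⊗ₜ[ℝ] (X : 𝔤) + Complex.I ⊗ₜ[ℝ] (S.J X : 𝔤) ∈ S.subalgebra01 := ⟨X, rfl⟩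
      have h2 := S.subalgebra01.smul_mem s h1
      change _ • _ + _ • _ ∈ S.subalgebra01
      convert h2 using 1
      simp [TensorProduct.smul_tmul']
    rw [h]
    exact hasDerivAt_const _ _
  have hI : D (0, 1) = Complex.I • D (1, 0) := by
    have h : ((1, Complex.I) : ℂ × ℂ) = (1, 0) + Complex.I • (0, 1) := by simp
    rw [h, map_add, map_smul] at h0
    rw [eq_neg_of_add_eq_zero_left h0, smul_neg, smul_smul, Complex.I_mul_I, neg_smul, one_smul,
      neg_neg]
  have hmul : ∀ (t : ℝ) (x : 𝔤), (p * exp (t • x)).complexify =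
      p.complexify * exp ((t : ℂ) • ((1 : ℂ) ⊗ₜ[ℝ] x)) := fun t x => by
    rw [complexify_mul]
    congr 1
    apply ExpGroup.ext
    simp [complexify, TensorProduct.smul_tmul', TensorProduct.tmul_smul]
  refine ⟨D (1, 0), ?_, ?_⟩
  · convert hreal (1, 0) using 2 with t
    simp [ψ, embed, hmul]
  · rw [← hI]
    convert hreal (0, 1) using 2 with t
    simp [ψ, embed, hmul]

lemma isCREmbedding_embed : B.IsCREmbedding B.embed where
  smooth := B.contDiff_embed_chart
  immersion := B.fderiv_embed_chart_injective
  embedding := B.isEmbedding_embed_chart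
  cr := B.exists_hasDerivAt_embed

/-- Changing t moves the point only modulo 𝔫_ℂ, and with it the factor in M. -/
lemma fst_embedComplex (u : Fin n ⊕ Fin n → ℂ) (t : Fin k → ℂ) :
    (B.embedComplex (Sum.elim u t)).1 = (B.embedComplex (Sum.elim u 0)).1 := by
  rw [← sub_eq_zero, ← Prod.fst_sub, embedComplex, embedComplex, ← map_sub]
  exact B.fst_chartMInv_eq_zero (S.factorM_sub_mem_subalgebraN (B.complexChart_sub_mem u t))

lemma hasPolynomialForm_embed : B.HasPolynomialForm B.embed := by
  have hP : ∀ j, ∃ P : MvPolynomial (Fin n ⊕ Fin n) ℂ,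
      ∀ u, (B.embedComplex (Sum.elim u 0)).1 j = P.eval u := fun j => by
    let e : (Fin n ⊕ Fin n → ℂ) →ₗ[ℂ] ((Fin n ⊕ Fin n) ⊕ Fin k → ℂ) :=
      LinearMap.pi (Sum.elim LinearMap.proj 0)
    have he : ∀ u, e u = Sum.elim u 0 := fun u => by
      funext i
      cases i <;> rfl
    have h := (B.isPolyMap_embedComplex.comp e.isPolyMap)
      (LinearMap.proj j ∘ₗ LinearMap.fst ℂ _ _)
    simpa [he] using exists_mvPolynomial_of_mem_polyFun h
  have hQ : ∀ l, ∃ Q : MvPolynomial ((Fin n ⊕ Fin n) ⊕ Fin k) ℂ,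
      ∀ v, (B.embedComplex v).2 l = Q.eval v := fun l =>
    exists_mvPolynomial_of_mem_polyFun (B.isPolyMap_embedComplex
      (LinearMap.proj l ∘ₗ LinearMap.snd ℂ _ _))
  choose P hP using hP
  choose Q hQ using hQ
  -- The leading terms are simply subtracted; what matters is that the components are polynomial and
  -- the first n do not involve t.
  refine ⟨fun j => P j - MvPolynomial.X (Sum.inl j) -
    MvPolynomial.C Complex.I * MvPolynomial.X (Sum.inr j),
    fun l => Q l - MvPolynomial.X (Sum.inr l), fun x y t => ?_⟩
  rw [embed_chart]
  refine Prod.ext (funext fun j => ?_) (funext fun l => ?_)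
  · rw [ofRealCoord, fst_embedComplex, hP]
    simp
  · rw [hQ]
    simp [ofRealCoord]

end HorizontalCRStructure.AdaptedBasis

end

/-! ### The theorem -/

theorem theorem2 {𝔤 : Type*} [LieRing 𝔤] [LieAlgebra ℝ 𝔤] [FiniteDimensional ℝ 𝔤]
    [LieRing.IsNilpotent 𝔤] (S : HorizontalCRStructure 𝔤) (n k : ℕ) (hS : S.IsOfType n k) :
    -- adapted bases exist, and for each of them the following holds
    Nonempty (S.AdaptedBasis n k) ∧ ∀ B : S.AdaptedBasis n k,
      -- the coordinates identify `ℂⁿ⁺ᵏ` with `M`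
      Function.Injective B.chartM ∧ Set.range B.chartM = S.M ∧
      -- the map `Φ : G_ℂ → M ≅ ℂⁿ⁺ᵏ`, given by `p H⁰¹ = Φ(p) H⁰¹`
      ∃ Φ : ExpGroup ℂ (ℂ ⊗[ℝ] 𝔤) → CSpace n k,
        (∀ p v, Φ p = v ↔ ∃ b ∈ S.H01, B.chartM v * b = p) ∧
        -- its restriction `ι` to `G` is a CR embedding of polynomial form
        ∃ ι : ExpGroup ℝ 𝔤 → CSpace n k,
          (∀ p, ι p = Φ p.complexify) ∧ B.IsCREmbedding ι ∧ B.HasPolynomialForm ι ∧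
          -- a right inverse `σ` of `Φ` that takes `ι(p)` to `p` for every `p` in `G`
          ∃ σ : CSpace n k → ExpGroup ℂ (ℂ ⊗[ℝ] 𝔤),
            Function.RightInverse σ Φ ∧ (∀ p, σ (ι p) = p.complexify) ∧
            -- the transported product is a group law, and `σ` and `ι` are homomorphisms
            ∃ grp : Group (CSpace n k),
              (∀ v w, grp.mul v w = Φ (σ v * σ w)) ∧
              (∀ v w, σ (grp.mul v w) = σ v * σ w) ∧
              (∀ p q, ι (p * q) = grp.mul (ι p) (ι q)) ∧
              Function.Injective ι ∧
              ∃ H : @Subgroup (CSpace n k) grp, (H : Set (CSpace n k)) = Set.range ι := by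
  refine ⟨S.nonempty_adaptedBasis hS, fun B => ⟨B.chartM_injective, B.range_chartM, B.mapM,
    fun _ _ => B.mapM_eq_iff, B.embed, fun _ => rfl, B.isCREmbedding_embed,
    B.hasPolynomialForm_embed, B.liftQ, B.mapM_liftQ, B.liftQ_embed, ?_⟩⟩
  -- The product is transported from Q, so the group axioms hold automatically and `B.liftQ` is a
  -- homomorphism.
  let grp : Group (CSpace n k) := B.equivQ.group
  have hσ : ∀ v w, B.liftQ (grp.mul v w) = B.liftQ v * B.liftQ w := fun v w =>
    B.liftQ_mapM (S.groupQ.mul_mem (B.liftQ_mem v) (B.liftQ_mem w))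
  have hι : ∀ p q, B.embed (p * q) = grp.mul (B.embed p) (B.embed q) := fun p q => by
    rw [← B.mapM_liftQ (grp.mul _ _), hσ, B.liftQ_embed, B.liftQ_embed, ← ExpGroup.complexify_mul]
    rfl
  exact ⟨grp, fun _ _ => rfl, hσ, hι, B.embed_injective,
    (MonoidHom.mk' B.embed hι).range, MonoidHom.coe_range _⟩
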